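/- Let $p>3$ be a prime and let $w$ be a generator of the multiplicative group $\mathbb{F}_p^*$. Write $[h,g]=h^{-1}g^{-1}hg$. In every presentation below the $p$-th powers of generators and the commutators $[g_j,g_i]$ ($i<j$) of generators that are not mentioned are understood to be trivial, and an exponent $w^k$ stands for its representative in $\{0,\dots,p-1\}$. For a finite $p$-group $H$ put $\gamma_0(H)=H$ and $\gamma_{i+1}(H)=\langle [h,g]k^p \mid h,k\in\gamma_i(H),\ g\in H\rangle$; the $p$-class of $H$ is the least $c$ with $\gamma_c(H)=1$. If $G$ is a finite $p$-group of $p$-class $c$, a finite $p$-group $H$ is an immediate descendant of $G$ if $H$ has the same minimal number of generators as $G$, $H/\gamma_c(H)\cong G$, and $H$ has $p$-class $c+1$. Let $G=\langle a_1,a_2,a_3,a_4 \mid [a_2,a_1]=a_3,\ [a_3,a_1]=a_4\rangle$. Then $|G|=p^4$, and the following groups, with $0\le a<\gcd(3,p-1)$ and $0\le b<\gcd(4,p-1)$, are immediate descendants of $G$ of order $p^5$, are pairwise non-isomorphic, and every immediate descendant of $G$ of order $p^5$ is isomorphic to one of them: - $G_1=\langle g_1,\dots,g_5 \mid [g_2,g_1]=g_3,\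 [g_3,g_1]=g_4,\ [g_4,g_1]=g_5\rangle$, - $G_2^a=\langle g_1,\dots,g_5 \mid [g_2,g_1]=g_3,\ [g_3,g_1]=g_4,\ [g_4,g_1]=g_5^{w^a},\ g_2^p=g_5\rangle$, - $G_3=\langle g_1,\dots,g_5 \mid [g_2,g_1]=g_3,\ [g_3,g_1]=g_4,\ [g_4,g_1]=g_5,\ g_1^p=g_5\rangle$, - $G_4=\langle g_1,\dots,g_5 \mid [g_2,g_1]=g_3,\ [g_3,g_1]=g_4,\ [g_4,g_1]=g_5,\ [g_3,g_2]=g_5\rangle$, - $G_5^a=\langle g_1,\dots,g_5 \mid [g_2,g_1]=g_3,\ [g_3,g_1]=g_4,\ [g_4,g_1]=g_5^{w^a},\ [g_3,g_2]=g_5^{w^a},\ g_2^p=g_5\rangle$, - $G_6^b=\langle g_1,\dots,g_5 \mid [g_2,g_1]=g_3,\ [g_3,g_1]=g_4,\ [g_4,g_1]=g_5^{w^b},\ [g_3,g_2]=g_5^{w^b},\ g_1^p=g_5\rangle$. In particular, the number of isomorphism classes of immediate descendants of $G$ of order $p^5$ is exactly $$3+\gcd(4,p-1)+2\gcd(3,p-1).$$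 -/

import Mathlib

universe u

namespace PDesc

/-- The commutator `[h, g] = h⁻¹ g⁻¹ h g`. -/
def comm {G : Type*} [Group G] (h g : G) : G := h⁻¹ * g⁻¹ * h * g

/-- The descending `p`-central series: `γ₀(G) = G` and
`γᵢ₊₁(G) = ⟨ [h, g] k ^ p ∣ h, k ∈ γᵢ(G), g ∈ G ⟩`. -/
def pSeries (p : ℕ) (G : Type*) [Group G] : ℕ → Subgroup G
  | 0 => ⊤
  | i + 1 => Subgroup.closure
      {x | ∃ h ∈ pSeries p G i, ∃ k ∈ pSeries p G i, ∃ g : G, x = comm h g * k ^ p}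

instance pSeries_normal (p : ℕ) (G : Type*) [Group G] (i : ℕ) : (pSeries p G i).Normal := by
  induction i with
  | zero => exact inferInstanceAs (⊤ : Subgroup G).Normal
  | succ i ih =>
    refine ⟨fun n hn c => ?_⟩
    change n ∈ Subgroup.closure _ at hn
    change c * n * c⁻¹ ∈ Subgroup.closure _
    induction hn using Subgroup.closure_induction with
    | mem x hx =>
      obtain ⟨h, hh, k, hk, g, rfl⟩ := hx
      refine Subgroup.subset_closure ⟨c * h * c⁻¹, ih.conj_mem h hh c, c * k * c⁻¹,
        ih.conj_mem k hk c, c * g * c⁻¹, ?_⟩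
      rw [conj_pow]
      simp only [comm]
      group
    | one => simp
    | mul x y _ _ hx hy =>
      have := mul_mem hx hy
      rwa [show c * x * c⁻¹ * (c * y * c⁻¹) = c * (x * y) * c⁻¹ by group] at this
    | inv x _ hx =>
      have := inv_mem hx
      rwa [show (c * x * c⁻¹)⁻¹ = c * x⁻¹ * c⁻¹ by group] at this

/-- `G` has `p`-class `c`: the number `c` is the least one with `γ_c(G) = 1`. -/
def HasPClass (p : ℕ) (G : Type*) [Group G] (c : ℕ) : Prop :=
  IsLeast {i | pSeries p G i = ⊥} c

/-- The finite `p`-group `H` is an immediate descendant of the finite `p`-group `G`: if `c` is the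
`p`-class of `G`, then `H` has the same minimal number of generators as `G`, the quotient
`H / γ_c(H)` is isomorphic to `G`, and `H` has `p`-class `c + 1`. -/
structure IsImmediateDescendant (p : ℕ) (G H : Type*) [Group G] [Group H]
    [Group.FG G] [Group.FG H] : Prop where
  finite_base : Finite G
  isPGroup_base : IsPGroup p G
  finite : Finite H
  isPGroup : IsPGroup p H
  rank_eq : Group.rank H = Group.rank G
  exists_pClass : ∃ c, HasPClass p G c ∧ Nonempty (H ⧸ pSeries p H c ≃* G) ∧ HasPClass p H (c + 1)

/-- The relators of the power-commutator presentation on generators `g₀, …, gₙ₋₁` with the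
relations `gᵢ ^ p = pow i` for all `i` and `[gⱼ, gᵢ] = com j i` for all `i < j`. -/
def pcRels (p n : ℕ) (pow : Fin n → FreeGroup (Fin n))
    (com : Fin n → Fin n → FreeGroup (Fin n)) : Set (FreeGroup (Fin n)) :=
  {r | ∃ i, r = FreeGroup.of i ^ p * (pow i)⁻¹} ∪
  {r | ∃ i j, i < j ∧ r = comm (FreeGroup.of j) (FreeGroup.of i) * (com j i)⁻¹}

/-- The group given by a power-commutator presentation. -/
abbrev PcGroup (p n : ℕ) (pow : Fin n → FreeGroup (Fin n))
    (com : Fin n → Fin n → FreeGroup (Fin n)) : Type :=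
  PresentedGroup (pcRels p n pow com)

/-- The group `⟨ a₁, a₂, a₃, a₄ ∣ [a₂, a₁] = a₃, [a₃, a₁] = a₄ ⟩`, where all `p`-th powers of
generators and all commutators of generators that are not mentioned are trivial.
The generator `aₖ` has index `k - 1`. -/
abbrev BaseGroup (p : ℕ) : Type :=
  PcGroup p 4 (fun _ => 1) fun j i =>
    if j = 1 ∧ i = 0 then FreeGroup.of 2
    else if j = 2 ∧ i = 0 then FreeGroup.of 3
    else 1

/-- The group `⟨ g₁, …, g₅ ∣ [g₂, g₁] = g₃, [g₃, g₁] = g₄, [g₄, g₁] = g₅ ^ x, [g₃, g₂] = g₅ ^ y,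
g₁ ^ p = g₅ ^ s, g₂ ^ p = g₅ ^ t ⟩`, where all `p`-th powers of generators and all commutators of
generators that are not mentioned are trivial. The generator `gₖ` has index `k - 1`. -/
abbrev ExtGroup (p x y s t : ℕ) : Type :=
  PcGroup p 5
    (fun i => if i = 0 then FreeGroup.of 4 ^ s else if i = 1 then FreeGroup.of 4 ^ t else 1)
    fun j i =>
      if j = 1 ∧ i = 0 then FreeGroup.of 2
      else if j = 2 ∧ i = 0 then FreeGroup.of 3
      else if j = 3 ∧ i = 0 then FreeGroup.of 4 ^ x
      else if j = 2 ∧ i = 1 then FreeGroup.of 4 ^ y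
      else 1

/-- The index set of the list of groups. -/
inductive Index (p : ℕ) : Type
  | G1
  | G2 (a : Fin (Nat.gcd 3 (p - 1)))
  | G3
  | G4
  | G5 (a : Fin (Nat.gcd 3 (p - 1)))
  | G6 (b : Fin (Nat.gcd 4 (p - 1)))

/-- The representative in `{0, …, p - 1}` of `w ^ a`. -/
def wPow {p : ℕ} (w : (ZMod p)ˣ) (a : ℕ) : ℕ := ((w : ZMod p) ^ a).val

/-- The exponents `(x, y, s, t)` in the relations `[g₄, g₁] = g₅ ^ x`, `[g₃, g₂] = g₅ ^ y`,
`g₁ ^ p = g₅ ^ s`, `g₂ ^ p = g₅ ^ t` of the groups in the list. -/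
def exponents {p : ℕ} (w : (ZMod p)ˣ) : Index p → ℕ × ℕ × ℕ × ℕ
  | .G1 => (1, 0, 0, 0)
  | .G2 a => (wPow w a, 0, 0, 1)
  | .G3 => (1, 0, 1, 0)
  | .G4 => (1, 1, 0, 0)
  | .G5 a => (wPow w a, wPow w a, 0, 1)
  | .G6 b => (wPow w b, wPow w b, 1, 0)

/-- The groups in the list. -/
abbrev ListedGroup {p : ℕ} (w : (ZMod p)ˣ) (i : Index p) : Type :=
  ExtGroup p (exponents w i).1 (exponents w i).2.1 (exponents w i).2.2.1 (exponents w i).2.2.2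

instance presentedGroup_fg {n : ℕ} (rels : Set (FreeGroup (Fin n))) :
    Group.FG (PresentedGroup rels) :=
  inferInstanceAs (Group.FG (FreeGroup (Fin n) ⧸ Subgroup.normalClosure rels))

/-- The set of isomorphism classes of immediate descendants of `G` of order `m`. -/
def descendantClasses (p : ℕ) (G : Type*) [Group G] [Group.FG G] (m : ℕ) :
    Set (Quotient (CategoryTheory.isIsomorphicSetoid GrpCat.{u})) :=
  {q | ∃ (H : GrpCat.{u}) (_ : Finite H), q = Quotient.mk _ H ∧ Nat.card H = m ∧
    IsImmediateDescendant p G H}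

end PDesc

/-! ### A polynomial model of the extension groups. -/

namespace PDesc

/-! An immediate descendant of order `p ^ 5` is a central extension of the base group by its last
series term, which has order `p`. Lifting the two generators and using the commutator and power
identities shows that it satisfies the relations of `ExtGroup p x y s t` for some exponents
(`exists_extRel_of_central`). So everything reduces to these four-parameter groups.

That such a group has order `p ^ 5` needs two bounds. The upper one comes from the central
generating sequence (`finite_and_card_le_of_central_generators`). The lower one comes from `Model`,
an explicit group law on `(ZMod p)^5`: the Baker-Campbell-Hausdorff product of the Lie algebra with
`[e₂,e₁] = e₃`, `[e₃,e₁] = e₄`, `[e₄,e₁] = x e₅`, `[e₃,e₂] = y e₅`, modified by carry cocycles that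
create the `p`-th powers. In the model, `p`-class 4 amounts to `x ≠ 0`.

Isomorphism becomes linear algebra. New generators `g₁ ↦ (α, β)`, `g₂ ↦ (0, δ)`, `g₅ ↦ l` change the
parameters by `x α³ δ = l x'`, `y α δ² = l y'`, `s α + t β = l s'`, `t δ = l t'`. Every such change
is realised (`Model.nonempty_extGroup_mulEquiv`) and every isomorphism between models with `x ≠ 0`
yields one (`Model.exists_change_of_generators`). The orbits are separated by the vanishing of `y`,
of `t` and, when `t = 0`, of `s`. What remains is a class modulo cubes if `t ≠ 0`, modulo fourth
powers if `t = 0` and `y`, `s` are nonzero, and nothing otherwise; this produces the two gcds. -/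

/-- The carry in the addition of two residues modulo `p`. -/
def carry {p : ℕ} (a b : ZMod p) : ZMod p := (((a.val + b.val) / p : ℕ) : ZMod p)

theorem carry_comm {p : ℕ} (a b : ZMod p) : carry a b = carry b a := by
  simp only [carry, add_comm]

theorem carry_zero {p : ℕ} [NeZero p] (a : ZMod p) : carry a 0 = 0 := by
  simp [carry, Nat.div_eq_of_lt a.val_lt]

theorem zero_carry {p : ℕ} [NeZero p] (a : ZMod p) : carry 0 a = 0 := by
  rw [carry_comm, carry_zero]

/-- This is the 2-cocycle identity. Both sides count the multiples of `p` dropped when three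
representatives are added, so the equality already holds for natural numbers. -/
theorem carry_assoc {p : ℕ} [NeZero p] (a b c : ZMod p) :
    carry a b + carry (a + b) c = carry b c + carry a (b + c) := by
  have hp : 0 < p := Nat.pos_of_ne_zero (NeZero.ne p)
  have key : ∀ m n : ZMod p, (m + n).val + p * ((m.val + n.val) / p) = m.val + n.val :=
    fun m n => by rw [ZMod.val_add, Nat.mod_add_div]
  have h : (a.val + b.val) / p + ((a + b).val + c.val) / p =
      (b.val + c.val) / p + (a.val + (b + c).val) / p := by
    have h1 := key a b
    have h2 := key (a + b) c
    have h3 := key b c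
    have h4 := key a (b + c)
    rw [← add_assoc] at h4
    apply Nat.eq_of_mul_eq_mul_left hp
    rw [mul_add, mul_add]
    omega
  simp only [carry]
  exact_mod_cast congrArg (Nat.cast : ℕ → ZMod p) h

/-- The carries met in forming a multiple of `a` add up to an integer quotient; this is the
induction step for powers in the model. -/
theorem carry_nsmul {p : ℕ} [NeZero p] (n : ℕ) (a : ZMod p) :
    (((n * a.val) / p : ℕ) : ZMod p) + carry ((n : ZMod p) * a) a =
      (((n + 1) * a.val / p : ℕ) : ZMod p) := by
  have hp : 0 < p := Nat.pos_of_ne_zero (NeZero.ne p)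
  have h1 : ((n : ZMod p) * a).val = (n * a.val) % p := by
    rw [ZMod.val_mul, ZMod.val_natCast, Nat.mod_mul_mod]
  rw [carry, h1, ← Nat.cast_add]
  congr 1
  have e : (n + 1) * a.val = (n * a.val % p + a.val) + p * (n * a.val / p) := by
    have := Nat.mod_add_div (n * a.val) p
    rw [add_mul, one_mul]; omega
  rw [e, Nat.add_mul_div_left _ _ hp, add_comm]

/-- A concrete model of the group `ExtGroup p x y s t`. The underlying set is that of a
five-dimensional Lie algebra with a scaled basis. The product is the Baker-Campbell-Hausdorff
product, twisted by a multiple of the carry cocycle. -/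
@[ext] structure Model (p : ℕ) (x y s t : ZMod p) : Type where
  a : ZMod p
  b : ZMod p
  c : ZMod p
  d : ZMod p
  e : ZMod p

namespace Model

variable {p : ℕ} {x y s t : ZMod p}

-- The tuple stands for `a e₁ + b e₂ + (c/2) e₃ + (d/12) e₄ + (e/24) e₅`. This scaling clears the
-- denominators of the Baker-Campbell-Hausdorff formula, so the group axioms are polynomial
-- identities with integer coefficients.
instance : Mul (Model p x y s t) where
  mul u v :=
    { a := u.a + v.a
      b := u.b + v.b
      c := u.c + v.c + (u.b * v.a - u.a * v.b)
      d := u.d + v.d + 3 * (u.c * v.a - u.a * v.c) - (u.a - v.a) * (u.b * v.a - u.a * v.b)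
      e := u.e + v.e + x * (u.d * v.a - u.a * v.d) + 6 * y * (u.c * v.b - u.b * v.c)
        - x * (u.a - v.a) * (u.c * v.a - u.a * v.c)
        - 2 * y * (u.b - v.b) * (u.b * v.a - u.a * v.b)
        - x * u.a * v.a * (u.b * v.a - u.a * v.b)
        + 24 * (s * carry u.a v.a + t * carry u.b v.b) }

instance : One (Model p x y s t) where
  one := ⟨0, 0, 0, 0, 0⟩

instance : Inv (Model p x y s t) where
  inv u := ⟨-u.a, -u.b, -u.c, -u.d, -u.e - 24 * (s * carry (-u.a) u.a + t * carry (-u.b) u.b)⟩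

theorem mul_a (u v : Model p x y s t) : (u * v).a = u.a + v.a := rfl
theorem mul_b (u v : Model p x y s t) : (u * v).b = u.b + v.b := rfl
theorem mul_c (u v : Model p x y s t) :
    (u * v).c = u.c + v.c + (u.b * v.a - u.a * v.b) := rfl
theorem mul_d (u v : Model p x y s t) :
    (u * v).d = u.d + v.d + 3 * (u.c * v.a - u.a * v.c)
      - (u.a - v.a) * (u.b * v.a - u.a * v.b) := rfl
theorem mul_e (u v : Model p x y s t) :
    (u * v).e = u.e + v.e + x * (u.d * v.a - u.a * v.d) + 6 * y * (u.c * v.b - u.b * v.c)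
        - x * (u.a - v.a) * (u.c * v.a - u.a * v.c)
        - 2 * y * (u.b - v.b) * (u.b * v.a - u.a * v.b)
        - x * u.a * v.a * (u.b * v.a - u.a * v.b)
        + 24 * (s * carry u.a v.a + t * carry u.b v.b) := rfl

theorem one_a : (1 : Model p x y s t).a = 0 := rfl
theorem one_b : (1 : Model p x y s t).b = 0 := rfl
theorem one_c : (1 : Model p x y s t).c = 0 := rfl
theorem one_d : (1 : Model p x y s t).d = 0 := rfl
theorem one_e : (1 : Model p x y s t).e = 0 := rfl

theorem inv_a (u : Model p x y s t) : u⁻¹.a = -u.a := rfl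
theorem inv_b (u : Model p x y s t) : u⁻¹.b = -u.b := rfl
theorem inv_c (u : Model p x y s t) : u⁻¹.c = -u.c := rfl
theorem inv_d (u : Model p x y s t) : u⁻¹.d = -u.d := rfl
theorem inv_e (u : Model p x y s t) :
    u⁻¹.e = -u.e - 24 * (s * carry (-u.a) u.a + t * carry (-u.b) u.b) := rfl

theorem mul_assoc' [NeZero p] (u v w : Model p x y s t) : u * v * w = u * (v * w) := by
  ext
  · simp only [mul_a]; ring
  · simp only [mul_b]; ring
  · simp only [mul_a, mul_b, mul_c]; ring
  · simp only [mul_a, mul_b, mul_c, mul_d]; ring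
  · simp only [mul_a, mul_b, mul_c, mul_d, mul_e]
    linear_combination 24 * s * carry_assoc u.a v.a w.a + 24 * t * carry_assoc u.b v.b w.b

instance [NeZero p] : Group (Model p x y s t) :=
  Group.ofLeftAxioms mul_assoc'
    (fun u => by
      ext <;> simp only [mul_a, mul_b, mul_c, mul_d, mul_e, one_a, one_b, one_c, one_d, one_e,
        zero_carry] <;> ring)
    (fun u => by
      ext <;> simp only [mul_a, mul_b, mul_c, mul_d, mul_e, one_a, one_b, one_c, one_d, one_e,
        inv_a, inv_b, inv_c, inv_d, inv_e] <;> ring)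

/-- The model as a set is the fifth power of `ZMod p`. -/
def equivProd : Model p x y s t ≃ ZMod p × ZMod p × ZMod p × ZMod p × ZMod p where
  toFun u := (u.a, u.b, u.c, u.d, u.e)
  invFun q := ⟨q.1, q.2.1, q.2.2.1, q.2.2.2.1, q.2.2.2.2⟩

instance [NeZero p] : Finite (Model p x y s t) := Finite.of_equiv _ equivProd.symm

theorem card_eq : Nat.card (Model p x y s t) = p ^ 5 := by
  rw [Nat.card_congr equivProd]
  simp only [Nat.card_prod, Nat.card_zmod]
  ring

variable [NeZero p]

theorem pow_eq (u : Model p x y s t) (n : ℕ) :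
    u ^ n = ⟨n * u.a, n * u.b, n * u.c, n * u.d,
      n * u.e + 24 * (s * ((n * u.a.val / p : ℕ) : ZMod p)
        + t * ((n * u.b.val / p : ℕ) : ZMod p))⟩ := by
  induction n with
  | zero => ext <;> simp [one_a, one_b, one_c, one_d, one_e]
  | succ n ih =>
    rw [pow_succ, ih]
    ext
    · simp only [mul_a]; push_cast; ring
    · simp only [mul_b]; push_cast; ring
    · simp only [mul_c]; push_cast; ring
    · simp only [mul_d]; push_cast; ring
    · simp only [mul_e]
      have h1 := carry_nsmul n u.a
      have h2 := carry_nsmul n u.b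
      rw [← h1, ← h2]
      push_cast
      ring

/-- All linear terms vanish modulo `p`; the carries alone survive, and `p` copies of `a` carry
exactly `a.val` times. -/
theorem pow_prime (u : Model p x y s t) : u ^ p = ⟨0, 0, 0, 0, 24 * (s * u.a + t * u.b)⟩ := by
  have hp : 0 < p := Nat.pos_of_ne_zero (NeZero.ne p)
  rw [pow_eq]
  simp [Nat.mul_div_cancel_left _ hp]

/-- The polynomial formula for the commutator in the model. -/
theorem comm_eq (u v : Model p x y s t) : comm u v =
    ⟨0, 0, 2 * (u.b * v.a - u.a * v.b),
      6 * (u.c * v.a - u.a * v.c) + 6 * (u.a + v.a) * (u.b * v.a - u.a * v.b),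
      2 * x * (u.d * v.a - u.a * v.d) + 6 * x * (u.a + v.a) * (u.c * v.a - u.a * v.c)
        + 12 * y * (u.c * v.b - u.b * v.c) + 12 * y * (u.b + v.b) * (u.b * v.a - u.a * v.b)
        + x * (4 * u.a ^ 2 + 6 * u.a * v.a + 4 * v.a ^ 2) * (u.b * v.a - u.a * v.b)⟩ := by
  -- In this form the carries of `u * v` and `v * u` cancel by symmetry, leaving a polynomial.
  have h : comm u v = (v * u)⁻¹ * (u * v) := by simp only [comm]; group
  rw [h]
  ext <;> simp only [mul_e, mul_a, mul_b, mul_c, mul_d, inv_a, inv_b, inv_c, inv_d, inv_e]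
  case e =>
    rw [carry_comm v.a, carry_comm v.b, add_comm v.a, add_comm v.b]
    ring
  all_goals ring

end Model
end PDesc

/-! ### Order bounds and homomorphisms for power-commutator presentations. -/

namespace PDesc

theorem comm_eq_one_iff {X : Type*} [Group X] {h g : X} : comm h g = 1 ↔ h * g = g * h := by
  rw [show comm h g = (g * h)⁻¹ * (h * g) by simp only [comm]; group, inv_mul_eq_one, eq_comm]

theorem mul_comm_comm {X : Type*} [Group X] (h g : X) : g * h * comm h g = h * g := by
  simp only [comm]; group

theorem map_comm {X Y F : Type*} [Group X] [Group Y] [FunLike F X Y] [MonoidHomClass F X Y]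
    (f : F) (h g : X) : f (comm h g) = comm (f h) (f g) := by
  simp only [comm, map_mul, map_inv]

/-- Extending a finite normal subgroup by an element that is central modulo it. -/
theorem exists_normal_extension {X : Type*} [Group X] {p : ℕ} (hp : 0 < p) (N : Subgroup X)
    [N.Normal] [Finite N] (g : X) (S : Set X) (hS : Subgroup.closure S = ⊤)
    (hg : ∀ h ∈ S, comm g h ∈ N) (hgp : g ^ p ∈ N) :
    ∃ M : Subgroup X, M.Normal ∧ Finite M ∧ Nat.card M ≤ p * Nat.card N ∧ N ≤ M ∧ g ∈ M ∧
      M ≤ N ⊔ Subgroup.zpowers g := by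
  let π := QuotientGroup.mk' N
  have hπ : ∀ h, π h = 1 ↔ h ∈ N := fun h => QuotientGroup.eq_one_iff h
  have hcen : ∀ h, π g * π h = π h * π g := by
    intro h
    have : h ∈ (Subgroup.centralizer {π g}).comap π := by
      have hle : Subgroup.closure S ≤ (Subgroup.centralizer {π g}).comap π := by
        rw [Subgroup.closure_le]
        intro k hk
        simp only [Subgroup.coe_comap, Set.mem_preimage, SetLike.mem_coe,
          Subgroup.mem_centralizer_singleton_iff]
        have := (hπ _).2 (hg k hk)
        rw [map_comm, comm_eq_one_iff] at this
        exact this.symm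
      exact hle (hS ▸ Subgroup.mem_top h)
    rw [Subgroup.mem_comap, Subgroup.mem_centralizer_singleton_iff] at this
    exact this.symm
  have hnorm : (Subgroup.zpowers (π g)).Normal := by
    refine ⟨fun n hn q => ?_⟩
    obtain ⟨k, rfl⟩ := hn
    obtain ⟨h, rfl⟩ := QuotientGroup.mk'_surjective N q
    have : Commute (π h) (π g ^ k) := Commute.zpow_right (hcen h).symm k
    have e : π h * π g ^ k * (π h)⁻¹ = π g ^ k := by rw [this.eq, mul_inv_cancel_right]
    exact ⟨k, e.symm⟩
  -- Modulo `N` the element `g` is central, so its powers form a normal subgroup there; `M` is the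
  -- preimage.
  let M := (Subgroup.zpowers (π g)).comap π
  have hNM : N ≤ M := fun h hh => by
    change π h ∈ Subgroup.zpowers (π g)
    rw [(hπ h).2 hh]
    exact one_mem _
  have hgM : g ∈ M := Subgroup.mem_zpowers (π g)
  let f : N × Fin p → M := fun q => ⟨q.1 * g ^ (q.2 : ℕ), M.mul_mem (hNM q.1.2) (M.pow_mem hgM _)⟩
  have hf : Function.Surjective f := by
    rintro ⟨m, k, hk⟩
    have hp' : (p : ℤ) ≠ 0 := by exact_mod_cast hp.ne'
    have h0 : 0 ≤ k % p := Int.emod_nonneg _ hp'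
    have h1 : k % p < p := Int.emod_lt_of_pos _ (by exact_mod_cast hp)
    have hkk : ((k % p).toNat : ℤ) = k % p := Int.toNat_of_nonneg h0
    have hmem : m * (g ^ (k % p).toNat)⁻¹ ∈ N := by
      rw [← hπ, map_mul, map_inv, map_pow, ← zpow_natCast, hkk, ← zpow_neg]
      change π g ^ k = π m at hk
      rw [← hk, ← zpow_add]
      have : k + -(k % p) = p * (k / p) := by
        have := Int.emod_add_mul_ediv k p; linarith
      rw [this, zpow_mul, zpow_natCast, ← map_pow, (hπ _).2 hgp, one_zpow]
    refine ⟨(⟨_, hmem⟩, ⟨(k % p).toNat, by omega⟩), ?_⟩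
    simp [f]
  refine ⟨M, hnorm.comap π, Finite.of_surjective f hf, ?_, hNM, hgM, ?_⟩
  · have := Nat.card_le_card_of_surjective f hf
    rwa [Nat.card_prod, Nat.card_fin, mul_comm] at this
  · rintro m ⟨k, hk⟩
    change π g ^ k = π m at hk
    have hmem : m * (g ^ k)⁻¹ ∈ N := by rw [← hπ, map_mul, map_inv, map_zpow, hk, mul_inv_cancel]
    have := mul_mem (Subgroup.mem_sup_left hmem : _ ∈ N ⊔ Subgroup.zpowers g)
      (Subgroup.mem_sup_right (Subgroup.mem_zpowers_iff.2 ⟨k, rfl⟩) : g ^ k ∈ _)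
    rwa [inv_mul_cancel_right] at this

/-- A group with a polycyclic generating sequence of length `n` that refines a central series and
all of whose factors have order dividing `p` has order at most `p ^ n`. -/
theorem finite_and_card_le_of_central_generators {X : Type*} [Group X] {p n : ℕ} (hp : 0 < p)
    (g : Fin n → X) (hg : Subgroup.closure (Set.range g) = ⊤)
    (hpow : ∀ i, g i ^ p ∈ Subgroup.closure (g '' {k | i < k}))
    (hcom : ∀ i j, i < j → comm (g j) (g i) ∈ Subgroup.closure (g '' {k | j < k})) :
    Finite X ∧ Nat.card X ≤ p ^ n := by
  -- The subgroup generated by the last `m` generators is built up from the bottom; each earlier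
  -- generator costs a factor of at most `p`.
  have key : ∀ m ≤ n, ∃ N : Subgroup X, N.Normal ∧ Finite N ∧ Nat.card N ≤ p ^ m ∧
      N = Subgroup.closure (g '' {k : Fin n | n - m ≤ (k : ℕ)}) := by
    intro m
    induction m with
    | zero =>
      intro _
      refine ⟨⊥, inferInstance, inferInstance, by simp, ?_⟩
      have : {k : Fin n | n - 0 ≤ (k : ℕ)} = ∅ := by
        ext k; simp
      rw [this, Set.image_empty, Subgroup.closure_empty]
    | succ m ih =>
      intro hm
      obtain ⟨N, hN, hNf, hNc, hNe⟩ := ih (by omega)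
      let i : Fin n := ⟨n - (m + 1), by omega⟩
      have hi : {k : Fin n | i < k} = {k : Fin n | n - m ≤ (k : ℕ)} := by
        ext k; simp only [Set.mem_ofPred_eq, i, Fin.lt_def]; omega
      have hmemN : ∀ k, i < k → g k ∈ N := fun k hk => by
        rw [hNe, ← hi]; exact Subgroup.subset_closure ⟨k, hk, rfl⟩
      obtain ⟨M, hM, hMf, hMc, hNM, hgM, hMle⟩ := exists_normal_extension hp N (g i) _ hg (by
        rintro _ ⟨k, rfl⟩
        rcases lt_trichotomy i k with h | rfl | h
        · have h2 := N.mul_mem (hN.conj_mem _ (N.inv_mem (hmemN k h)) (g i)⁻¹) (hmemN k h)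
          simpa only [comm, inv_inv, mul_assoc] using h2
        · rw [comm_eq_one_iff.2 rfl]; exact N.one_mem
        · rw [hNe, ← hi]; exact hcom k i h) (by rw [hNe, ← hi]; exact hpow i)
      refine ⟨M, hM, hMf, hMc.trans (by rw [pow_succ']; gcongr), le_antisymm ?_ ?_⟩
      · refine hMle.trans (sup_le ?_ ?_)
        · rw [hNe]
          refine Subgroup.closure_mono (Set.image_mono fun k hk => ?_)
          simp only [Set.mem_ofPred_eq] at hk ⊢
          omega
        · rw [Subgroup.zpowers_le]
          exact Subgroup.subset_closure ⟨i, le_refl (n - (m + 1)), rfl⟩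
      · rw [Subgroup.closure_le]
        rintro _ ⟨k, hk, rfl⟩
        rcases eq_or_lt_of_le (show i ≤ k from hk) with rfl | h
        · exact hgM
        · exact hNM (hmemN k h)
  obtain ⟨N, -, hNf, hNc, hNe⟩ := key n le_rfl
  have hN : N = ⊤ := by
    rw [hNe, ← hg]
    congr 1
    ext h
    simp
  subst hN
  refine ⟨Finite.of_equiv _ Subgroup.topEquiv.toEquiv, ?_⟩
  rwa [Subgroup.card_top] at hNc

/-- The elements `g₁, …, g₅` satisfy the defining relations of `ExtGroup p x y s t`. -/
structure ExtRel {X : Type*} [Group X] (p x y s t : ℕ) (g₁ g₂ g₃ g₄ g₅ : X) : Prop where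
  pow₁ : g₁ ^ p = g₅ ^ s
  pow₂ : g₂ ^ p = g₅ ^ t
  pow₃ : g₃ ^ p = 1
  pow₄ : g₄ ^ p = 1
  pow₅ : g₅ ^ p = 1
  com₂₁ : comm g₂ g₁ = g₃
  com₃₁ : comm g₃ g₁ = g₄
  com₄₁ : comm g₄ g₁ = g₅ ^ x
  com₅₁ : comm g₅ g₁ = 1
  com₃₂ : comm g₃ g₂ = g₅ ^ y
  com₄₂ : comm g₄ g₂ = 1
  com₅₂ : comm g₅ g₂ = 1
  com₄₃ : comm g₄ g₃ = 1
  com₅₃ : comm g₅ g₃ = 1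
  com₅₄ : comm g₅ g₄ = 1

/-- The elements `a₁, …, a₄` satisfy the defining relations of `BaseGroup p`. -/
structure BaseRel {X : Type*} [Group X] (p : ℕ) (a₁ a₂ a₃ a₄ : X) : Prop where
  pow₁ : a₁ ^ p = 1
  pow₂ : a₂ ^ p = 1
  pow₃ : a₃ ^ p = 1
  pow₄ : a₄ ^ p = 1
  com₂₁ : comm a₂ a₁ = a₃
  com₃₁ : comm a₃ a₁ = a₄
  com₄₁ : comm a₄ a₁ = 1
  com₃₂ : comm a₃ a₂ = 1
  com₄₂ : comm a₄ a₂ = 1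
  com₄₃ : comm a₄ a₃ = 1

theorem pcGroup_pow {p n : ℕ} (pow : Fin n → FreeGroup (Fin n))
    (com : Fin n → Fin n → FreeGroup (Fin n)) (i : Fin n) :
    (PresentedGroup.of i : PcGroup p n pow com) ^ p = PresentedGroup.mk _ (pow i) := by
  have : PresentedGroup.mk (pcRels p n pow com) (FreeGroup.of i ^ p * (pow i)⁻¹) = 1 :=
    PresentedGroup.one_of_mem (Or.inl ⟨i, rfl⟩)
  rwa [map_mul, map_inv, mul_inv_eq_one, map_pow] at this

theorem pcGroup_comm {p n : ℕ} (pow : Fin n → FreeGroup (Fin n))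
    (com : Fin n → Fin n → FreeGroup (Fin n)) {i j : Fin n} (h : i < j) :
    comm (PresentedGroup.of j : PcGroup p n pow com) (PresentedGroup.of i) =
      PresentedGroup.mk _ (com j i) := by
  have : PresentedGroup.mk (pcRels p n pow com)
      (comm (FreeGroup.of j) (FreeGroup.of i) * (com j i)⁻¹) = 1 :=
    PresentedGroup.one_of_mem (Or.inr ⟨i, j, h, rfl⟩)
  rwa [map_mul, map_inv, mul_inv_eq_one, map_comm] at this

/-- A homomorphism out of a power-commutator presentation. -/
theorem exists_pcGroup_hom {X : Type*} [Group X] {p n : ℕ} (pow : Fin n → FreeGroup (Fin n))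
    (com : Fin n → Fin n → FreeGroup (Fin n)) (g : Fin n → X)
    (hpow : ∀ i, g i ^ p = FreeGroup.lift g (pow i))
    (hcom : ∀ i j, i < j → comm (g j) (g i) = FreeGroup.lift g (com j i)) :
    ∃ f : PcGroup p n pow com →* X, ∀ i, f (PresentedGroup.of i) = g i := by
  have h : ∀ r ∈ pcRels p n pow com, FreeGroup.lift g r = 1 := by
    rintro r (⟨i, rfl⟩ | ⟨i, j, hij, rfl⟩)
    · rw [map_mul, map_inv, map_pow, FreeGroup.lift_apply_of, hpow, mul_inv_cancel]
    · rw [map_mul, map_inv, map_comm, FreeGroup.lift_apply_of, FreeGroup.lift_apply_of, hcom i j hij,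
        mul_inv_cancel]
  exact ⟨PresentedGroup.toGroup h, fun i => PresentedGroup.toGroup.of h⟩

theorem surjective_of_closure {X Y : Type*} [Group X] [Group Y] (f : X →* Y) (S : Set Y)
    (hS : Subgroup.closure S = ⊤) (hf : ∀ g ∈ S, g ∈ f.range) : Function.Surjective f := by
  rw [← MonoidHom.range_eq_top, eq_top_iff, ← hS, Subgroup.closure_le]
  exact hf

theorem extGroup_rel (p x y s t : ℕ) : ExtRel p x y s t (PresentedGroup.of 0 : ExtGroup p x y s t)
    (PresentedGroup.of 1) (PresentedGroup.of 2) (PresentedGroup.of 3) (PresentedGroup.of 4) := by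
  constructor
  case com₂₁ | com₃₁ | com₄₁ | com₅₁ | com₃₂ | com₄₂ | com₅₂ | com₄₃ | com₅₃ | com₅₄ =>
    refine (pcGroup_comm _ _ (by decide)).trans ?_
    simp [PresentedGroup.of]
  all_goals
    refine (pcGroup_pow _ _ _).trans ?_
    simp [PresentedGroup.of]

theorem baseGroup_rel (p : ℕ) : BaseRel p (PresentedGroup.of 0 : BaseGroup p)
    (PresentedGroup.of 1) (PresentedGroup.of 2) (PresentedGroup.of 3) := by
  constructor
  case com₂₁ | com₃₁ | com₄₁ | com₃₂ | com₄₂ | com₄₃ =>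
    refine (pcGroup_comm _ _ (by decide)).trans ?_
    simp [PresentedGroup.of]
  all_goals
    refine (pcGroup_pow _ _ _).trans ?_
    simp

theorem exists_extGroup_hom {X : Type*} [Group X] {p x y s t : ℕ} {g₁ g₂ g₃ g₄ g₅ : X}
    (h : ExtRel p x y s t g₁ g₂ g₃ g₄ g₅)
    (hg : Subgroup.closure {g₁, g₂, g₃, g₄, g₅} = ⊤) :
    ∃ f : ExtGroup p x y s t →* X, Function.Surjective f := by
  obtain ⟨f, hf⟩ := exists_pcGroup_hom (p := p)
    (fun i => if i = 0 then FreeGroup.of 4 ^ s else if i = 1 then FreeGroup.of 4 ^ t else 1)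
    (fun j i =>
      if j = 1 ∧ i = 0 then FreeGroup.of 2
      else if j = 2 ∧ i = 0 then FreeGroup.of 3
      else if j = 3 ∧ i = 0 then FreeGroup.of 4 ^ x
      else if j = 2 ∧ i = 1 then FreeGroup.of 4 ^ y
      else 1) ![g₁, g₂, g₃, g₄, g₅]
    (by
      intro i
      fin_cases i
      · simpa using h.pow₁
      · simpa using h.pow₂
      · simpa using h.pow₃
      · simpa using h.pow₄
      · simpa using h.pow₅)
    (by
      intro i j hij
      fin_cases i <;> fin_cases j <;> first | exact absurd hij (by decide) | skip
      · simpa using h.com₂₁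
      · simpa using h.com₃₁
      · simpa using h.com₄₁
      · simpa using h.com₅₁
      · simpa using h.com₃₂
      · simpa using h.com₄₂
      · simpa using h.com₅₂
      · simpa using h.com₄₃
      · simpa using h.com₅₃
      · simpa using h.com₅₄)
  refine ⟨f, surjective_of_closure f _ hg ?_⟩
  rintro _ (rfl | rfl | rfl | rfl | rfl)
  exacts [⟨_, hf 0⟩, ⟨_, hf 1⟩, ⟨_, hf 2⟩, ⟨_, hf 3⟩, ⟨_, hf 4⟩]

theorem exists_baseGroup_hom {X : Type*} [Group X] {p : ℕ} {a₁ a₂ a₃ a₄ : X}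
    (h : BaseRel p a₁ a₂ a₃ a₄) (hg : Subgroup.closure {a₁, a₂, a₃, a₄} = ⊤) :
    ∃ f : BaseGroup p →* X, Function.Surjective f := by
  obtain ⟨f, hf⟩ := exists_pcGroup_hom (p := p) (fun _ => 1)
    (fun j i => if j = 1 ∧ i = 0 then FreeGroup.of 2
      else if j = 2 ∧ i = 0 then FreeGroup.of 3 else 1) ![a₁, a₂, a₃, a₄]
    (by
      intro i
      fin_cases i
      · simpa using h.pow₁
      · simpa using h.pow₂
      · simpa using h.pow₃
      · simpa using h.pow₄)
    (by
      intro i j hij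
      fin_cases i <;> fin_cases j <;> first | exact absurd hij (by decide) | skip
      · simpa using h.com₂₁
      · simpa using h.com₃₁
      · simpa using h.com₄₁
      · simpa using h.com₃₂
      · simpa using h.com₄₂
      · simpa using h.com₄₃)
  refine ⟨f, surjective_of_closure f _ hg ?_⟩
  rintro _ (rfl | rfl | rfl | rfl)
  exacts [⟨_, hf 0⟩, ⟨_, hf 1⟩, ⟨_, hf 2⟩, ⟨_, hf 3⟩]

theorem mem_of_eq {X : Type*} [Group X] {K : Subgroup X} {g h : X} (e : g = h) (hh : h ∈ K) :
    g ∈ K := e ▸ hh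

theorem ExtRel.finite_card_le {X : Type*} [Group X] {p x y s t : ℕ} (hp : 0 < p) (g : Fin 5 → X)
    (hg : Subgroup.closure (Set.range g) = ⊤)
    (R : ExtRel p x y s t (g 0) (g 1) (g 2) (g 3) (g 4)) :
    Finite X ∧ Nat.card X ≤ p ^ 5 := by
  have mem : ∀ i k : Fin 5, i < k → ∀ n, g k ^ n ∈ Subgroup.closure (g '' {k | i < k}) :=
    fun i k h n => pow_mem (Subgroup.subset_closure (show g k ∈ g '' {k | i < k} from ⟨k, h, rfl⟩)) n
  refine finite_and_card_le_of_central_generators hp g hg ?_ ?_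
  · intro i
    match i with
    | 0 => exact mem_of_eq R.pow₁ (mem 0 4 (by decide) s)
    | 1 => exact mem_of_eq R.pow₂ (mem 1 4 (by decide) t)
    | 2 => exact mem_of_eq R.pow₃ (one_mem _)
    | 3 => exact mem_of_eq R.pow₄ (one_mem _)
    | 4 => exact mem_of_eq R.pow₅ (one_mem _)
  · intro i j hij
    match i, j, hij with
    | 0, 1, _ => exact mem_of_eq (R.com₂₁.trans (pow_one _).symm) (mem 1 2 (by decide) 1)
    | 0, 2, _ => exact mem_of_eq (R.com₃₁.trans (pow_one _).symm) (mem 2 3 (by decide) 1)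
    | 0, 3, _ => exact mem_of_eq R.com₄₁ (mem 3 4 (by decide) x)
    | 0, 4, _ => exact mem_of_eq R.com₅₁ (one_mem _)
    | 1, 2, _ => exact mem_of_eq R.com₃₂ (mem 2 4 (by decide) y)
    | 1, 3, _ => exact mem_of_eq R.com₄₂ (one_mem _)
    | 1, 4, _ => exact mem_of_eq R.com₅₂ (one_mem _)
    | 2, 3, _ => exact mem_of_eq R.com₄₃ (one_mem _)
    | 2, 4, _ => exact mem_of_eq R.com₅₃ (one_mem _)
    | 3, 4, _ => exact mem_of_eq R.com₅₄ (one_mem _)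
    | ⟨n + 4, hn⟩, ⟨m, hm⟩, h => exact absurd h (by rw [Fin.mk_lt_mk]; omega)

theorem BaseRel.finite_card_le {X : Type*} [Group X] {p : ℕ} (hp : 0 < p) (g : Fin 4 → X)
    (hg : Subgroup.closure (Set.range g) = ⊤) (R : BaseRel p (g 0) (g 1) (g 2) (g 3)) :
    Finite X ∧ Nat.card X ≤ p ^ 4 := by
  have mem : ∀ i k : Fin 4, i < k → g k ∈ Subgroup.closure (g '' {k | i < k}) :=
    fun i k h => Subgroup.subset_closure (show g k ∈ g '' {k | i < k} from ⟨k, h, rfl⟩)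
  refine finite_and_card_le_of_central_generators hp g hg ?_ ?_
  · intro i
    match i with
    | 0 => exact mem_of_eq R.pow₁ (one_mem _)
    | 1 => exact mem_of_eq R.pow₂ (one_mem _)
    | 2 => exact mem_of_eq R.pow₃ (one_mem _)
    | 3 => exact mem_of_eq R.pow₄ (one_mem _)
  · intro i j hij
    match i, j, hij with
    | 0, 1, _ => exact mem_of_eq R.com₂₁ (mem 1 2 (by decide))
    | 0, 2, _ => exact mem_of_eq R.com₃₁ (mem 2 3 (by decide))
    | 0, 3, _ => exact mem_of_eq R.com₄₁ (one_mem _)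
    | 1, 2, _ => exact mem_of_eq R.com₃₂ (one_mem _)
    | 1, 3, _ => exact mem_of_eq R.com₄₂ (one_mem _)
    | 2, 3, _ => exact mem_of_eq R.com₄₃ (one_mem _)
    | ⟨n + 3, hn⟩, ⟨m, hm⟩, h => exact absurd h (by rw [Fin.mk_lt_mk]; omega)

theorem extGroup_finite_card_le {p : ℕ} (hp : 0 < p) (x y s t : ℕ) :
    Finite (ExtGroup p x y s t) ∧ Nat.card (ExtGroup p x y s t) ≤ p ^ 5 :=
  (extGroup_rel p x y s t).finite_card_le hp PresentedGroup.of (PresentedGroup.closure_range_of _)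

theorem baseGroup_finite_card_le {p : ℕ} (hp : 0 < p) :
    Finite (BaseGroup p) ∧ Nat.card (BaseGroup p) ≤ p ^ 4 :=
  (baseGroup_rel p).finite_card_le hp PresentedGroup.of (PresentedGroup.closure_range_of _)

/-- A surjection from a finite group onto a group that is at least as large is an isomorphism. -/
theorem nonempty_mulEquiv_of_surjective {X Y : Type*} [Group X] [Group Y] [Finite X] (f : X →* Y)
    (hf : Function.Surjective f) (hc : Nat.card X ≤ Nat.card Y) : Nonempty (X ≃* Y) := by
  have : Finite Y := Finite.of_surjective f hf
  have hb : Function.Bijective f :=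
    (Nat.bijective_iff_surjective_and_card f).2 ⟨hf, le_antisymm hc (Nat.card_le_card_of_surjective f hf)⟩
  exact ⟨MulEquiv.ofBijective f hb⟩

/-- A group of order `p ^ 5` generated by elements that satisfy the defining relations is
isomorphic to `ExtGroup p x y s t`. -/
theorem nonempty_extGroup_mulEquiv {X : Type*} [Group X] {p x y s t : ℕ} (hp : 0 < p)
    {g₁ g₂ g₃ g₄ g₅ : X} (h : ExtRel p x y s t g₁ g₂ g₃ g₄ g₅)
    (hg : Subgroup.closure {g₁, g₂, g₃, g₄, g₅} = ⊤) (hX : Nat.card X = p ^ 5) :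
    Nonempty (ExtGroup p x y s t ≃* X) := by
  obtain ⟨f, hf⟩ := exists_extGroup_hom h hg
  obtain ⟨h1, h2⟩ := extGroup_finite_card_le hp x y s t
  exact nonempty_mulEquiv_of_surjective f hf (hX ▸ h2)

end PDesc

/-! ### Generators of the model and its presentations. -/

namespace PDesc
namespace Model

variable {p : ℕ} [Fact p.Prime] {x y s t : ZMod p}

theorem natCast_val_div_mul (a : ZMod p) {b : ZMod p} (hb : b ≠ 0) :
    (((a / b).val : ℕ) : ZMod p) * b = a := by
  rw [ZMod.natCast_zmod_val, div_mul_cancel₀ _ hb]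

theorem mem_of_layer₅ {K : Subgroup (Model p x y s t)} {e : ZMod p} (he : e ≠ 0)
    (h : ⟨0, 0, 0, 0, e⟩ ∈ K) (e' : ZMod p) : (⟨0, 0, 0, 0, e'⟩ : Model p x y s t) ∈ K := by
  have := K.pow_mem h (e' / e).val
  rw [pow_eq] at this
  convert this using 1
  ext <;> simp [natCast_val_div_mul _ he, -ZMod.natCast_val]

/-- Triangular elimination: powers act linearly on the first four coordinates, so a suitable power
of each generator clears the next coordinate of a given element. -/
theorem closure_eq_top {K : Subgroup (Model p x y s t)} {g₁ g₂ g₃ g₄ : Model p x y s t}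
    {e : ZMod p} (h₁ : g₁ ∈ K) (ha₁ : g₁.a ≠ 0) (h₂ : g₂ ∈ K) (ha₂ : g₂.a = 0) (hb₂ : g₂.b ≠ 0)
    (h₃ : g₃ ∈ K) (ha₃ : g₃.a = 0) (hb₃ : g₃.b = 0) (hc₃ : g₃.c ≠ 0)
    (h₄ : g₄ ∈ K) (ha₄ : g₄.a = 0) (hb₄ : g₄.b = 0) (hc₄ : g₄.c = 0) (hd₄ : g₄.d ≠ 0)
    (h₅ : ⟨0, 0, 0, 0, e⟩ ∈ K) (he : e ≠ 0) : K = ⊤ := by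
  have red : ∀ {u g : Model p x y s t} (n : ℕ), g ∈ K → u * (g ^ n)⁻¹ ∈ K → u ∈ K :=
    fun n hg hu => by simpa using K.mul_mem hu (K.pow_mem hg n)
  have m5 : ∀ u : Model p x y s t, u.a = 0 → u.b = 0 → u.c = 0 → u.d = 0 → u ∈ K := by
    intro u ha hb hc hd
    convert mem_of_layer₅ he h₅ u.e using 1
    ext <;> simp [ha, hb, hc, hd]
  have m4 : ∀ u : Model p x y s t, u.a = 0 → u.b = 0 → u.c = 0 → u ∈ K := by
    intro u ha hb hc
    refine red (u.d / g₄.d).val h₄ (m5 _ ?_ ?_ ?_ ?_) <;>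
      simp only [mul_a, mul_b, mul_c, mul_d, inv_a, inv_b, inv_c, inv_d, pow_eq, ha, hb, hc, ha₄,
        hb₄, hc₄, natCast_val_div_mul _ hd₄] <;> ring
  have m3 : ∀ u : Model p x y s t, u.a = 0 → u.b = 0 → u ∈ K := by
    intro u ha hb
    refine red (u.c / g₃.c).val h₃ (m4 _ ?_ ?_ ?_) <;>
      simp only [mul_a, mul_b, mul_c, inv_a, inv_b, inv_c, pow_eq, ha, hb, ha₃,
        hb₃, natCast_val_div_mul _ hc₃] <;> ring
  have m2 : ∀ u : Model p x y s t, u.a = 0 → u ∈ K := by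
    intro u ha
    refine red (u.b / g₂.b).val h₂ (m3 _ ?_ ?_) <;>
      simp only [mul_a, mul_b, inv_a, inv_b, pow_eq, ha, ha₂, natCast_val_div_mul _ hb₂] <;> ring
  rw [eq_top_iff]
  intro u _
  refine red (u.a / g₁.a).val h₁ (m2 _ ?_)
  simp only [mul_a, inv_a, pow_eq, natCast_val_div_mul _ ha₁]
  ring

theorem two_ne_zero' (hp : 3 < p) : (2 : ZMod p) ≠ 0 := by
  intro h
  have : ((2 : ℕ) : ZMod p) = 0 := by exact_mod_cast h
  rw [ZMod.natCast_eq_zero_iff] at this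
  exact absurd (Nat.le_of_dvd (by norm_num) this) (by omega)

theorem three_ne_zero' (hp : 3 < p) : (3 : ZMod p) ≠ 0 := by
  intro h
  have : ((3 : ℕ) : ZMod p) = 0 := by exact_mod_cast h
  rw [ZMod.natCast_eq_zero_iff] at this
  exact absurd (Nat.le_of_dvd (by norm_num) this) (by omega)

theorem six_ne_zero' (hp : 3 < p) : (6 : ZMod p) ≠ 0 := by
  rw [show (6 : ZMod p) = 2 * 3 by norm_num]
  exact mul_ne_zero (two_ne_zero' hp) (three_ne_zero' hp)

theorem twelve_ne_zero' (hp : 3 < p) : (12 : ZMod p) ≠ 0 := by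
  rw [show (12 : ZMod p) = 2 * 6 by norm_num]
  exact mul_ne_zero (two_ne_zero' hp) (six_ne_zero' hp)

theorem twentyfour_ne_zero' (hp : 3 < p) : (24 : ZMod p) ≠ 0 := by
  rw [show (24 : ZMod p) = 2 * 12 by norm_num]
  exact mul_ne_zero (two_ne_zero' hp) (twelve_ne_zero' hp)

/-- A change of generators in the model. -/
theorem extRel {α β δ l : ZMod p} {x' y' s' t' : ℕ}
    (hx : x * α ^ 3 * δ = l * x') (hy : y * α * δ ^ 2 = l * y')
    (hs : s * α + t * β = l * s') (ht : t * δ = l * t') :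
    ExtRel p x' y' s' t' (⟨α, β, 0, 0, 0⟩ : Model p x y s t) ⟨0, δ, 0, 0, 0⟩
      (comm ⟨0, δ, 0, 0, 0⟩ ⟨α, β, 0, 0, 0⟩)
      (comm (comm ⟨0, δ, 0, 0, 0⟩ ⟨α, β, 0, 0, 0⟩) ⟨α, β, 0, 0, 0⟩) ⟨0, 0, 0, 0, 24 * l⟩ := by
  constructor
  case com₂₁ => rfl
  case com₃₁ => rfl
  case pow₁ =>
    rw [pow_prime, pow_eq]
    ext <;> simp
    linear_combination 24 * hs
  case pow₂ =>
    rw [pow_prime, pow_eq]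
    ext <;> simp
    linear_combination 24 * ht
  case com₄₁ =>
    simp only [comm_eq, pow_eq]
    ext <;> simp
    linear_combination 24 * hx
  case com₃₂ =>
    simp only [comm_eq, pow_eq]
    ext <;> simp
    linear_combination 24 * hy
  case pow₃ | pow₄ | pow₅ =>
    simp only [comm_eq, pow_prime]
    ext <;> simp [one_a, one_b, one_c, one_d, one_e]
  all_goals
    simp only [comm_eq]
    ext <;> simp [one_a, one_b, one_c, one_d, one_e]

theorem closure_generators_eq_top (hp : 3 < p) {α β δ l : ZMod p} (hα : α ≠ 0)
    (hδ : δ ≠ 0) (hl : l ≠ 0) :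
    Subgroup.closure {(⟨α, β, 0, 0, 0⟩ : Model p x y s t), ⟨0, δ, 0, 0, 0⟩,
      comm ⟨0, δ, 0, 0, 0⟩ ⟨α, β, 0, 0, 0⟩,
      comm (comm ⟨0, δ, 0, 0, 0⟩ ⟨α, β, 0, 0, 0⟩) ⟨α, β, 0, 0, 0⟩, ⟨0, 0, 0, 0, 24 * l⟩} = ⊤ := by
  refine closure_eq_top (g₁ := ⟨α, β, 0, 0, 0⟩) (g₂ := ⟨0, δ, 0, 0, 0⟩)
      (g₃ := comm ⟨0, δ, 0, 0, 0⟩ ⟨α, β, 0, 0, 0⟩)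
      (g₄ := comm (comm ⟨0, δ, 0, 0, 0⟩ ⟨α, β, 0, 0, 0⟩) ⟨α, β, 0, 0, 0⟩) (e := 24 * l)
      (Subgroup.subset_closure (by simp)) hα (Subgroup.subset_closure (by simp)) rfl hδ
      (Subgroup.subset_closure (by simp)) ?_ ?_ ?_ (Subgroup.subset_closure (by simp)) ?_ ?_ ?_ ?_
      (Subgroup.subset_closure (by simp)) (mul_ne_zero (twentyfour_ne_zero' hp) hl)
  all_goals simp [comm_eq, hα, hδ, two_ne_zero' hp, six_ne_zero' hp]

/-- With trivial constants this identifies a presented group with its model; with general ones it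
brings the parameters to normal form. -/
theorem nonempty_extGroup_mulEquiv (hp : 3 < p) {α β δ l : ZMod p} {x' y' s' t' : ℕ} (hα : α ≠ 0)
    (hδ : δ ≠ 0) (hl : l ≠ 0)
    (hx : x * α ^ 3 * δ = l * x') (hy : y * α * δ ^ 2 = l * y')
    (hs : s * α + t * β = l * s') (ht : t * δ = l * t') :
    Nonempty (ExtGroup p x' y' s' t' ≃* Model p x y s t) := by
  exact PDesc.nonempty_extGroup_mulEquiv (by omega) (extRel hx hy hs ht)
    (closure_generators_eq_top hp hα hδ hl) card_eq

theorem nonempty_extGroup_mulEquiv_natCast (hp : 3 < p) (x y s t : ℕ) :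
    Nonempty (ExtGroup p x y s t ≃* Model p x y s t) :=
  nonempty_extGroup_mulEquiv hp (α := 1) (β := 0) (δ := 1) (l := 1) one_ne_zero one_ne_zero
    one_ne_zero (by ring) (by ring) (by ring) (by ring)

/-! ### The descending central series of the model. -/

theorem mem_pSeries_one {u : Model p x y s t} (hu : u ∈ pSeries p (Model p x y s t) 1) :
    u.a = 0 ∧ u.b = 0 := by
  induction hu using Subgroup.closure_induction with
  | mem u hu =>
    obtain ⟨h, -, k, -, g, rfl⟩ := hu
    simp [mul_a, mul_b, comm_eq, pow_prime]
  | one => exact ⟨rfl, rfl⟩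
  | mul u v _ _ hu hv => simp [mul_a, mul_b, hu, hv]
  | inv u _ hu => simp [inv_a, inv_b, hu]

theorem mem_pSeries_two {u : Model p x y s t} (hu : u ∈ pSeries p (Model p x y s t) 2) :
    u.a = 0 ∧ u.b = 0 ∧ u.c = 0 := by
  induction hu using Subgroup.closure_induction with
  | mem u hu =>
    obtain ⟨h, hh, k, -, g, rfl⟩ := hu
    simp [mul_a, mul_b, mul_c, comm_eq, pow_prime, mem_pSeries_one hh]
  | one => exact ⟨rfl, rfl, rfl⟩
  | mul u v _ _ hu hv => simp [mul_a, mul_b, mul_c, hu, hv]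
  | inv u _ hu => simp [inv_a, inv_b, inv_c, hu]

/-- An element of the third term of the series lies in the last layer, and its last coordinate
vanishes if `x` does. -/
theorem mem_pSeries_three {u : Model p x y s t} (hu : u ∈ pSeries p (Model p x y s t) 3) :
    u.a = 0 ∧ u.b = 0 ∧ u.c = 0 ∧ u.d = 0 ∧ (x = 0 → u.e = 0) := by
  induction hu using Subgroup.closure_induction with
  | mem u hu =>
    obtain ⟨h, hh, k, hk, g, rfl⟩ := hu
    -- Since `h` has only `d` and `e` coordinates, its commutators have last coordinate a multiple
    -- of `x`; and `k ^ p` is trivial because `k.a = k.b = 0`.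
    have hx : x = 0 → comm h g * k ^ p = 1 := by
      rintro rfl
      ext <;> simp [mul_a, mul_b, mul_c, mul_d, mul_e, comm_eq, pow_prime, mem_pSeries_two hh,
        mem_pSeries_two hk, one_a, one_b, one_c, one_d, one_e, zero_carry]
    refine ⟨?_, ?_, ?_, ?_, fun h => by rw [hx h, one_e]⟩ <;>
      simp [mul_a, mul_b, mul_c, mul_d, comm_eq, pow_prime, mem_pSeries_two hh]
  | one => exact ⟨rfl, rfl, rfl, rfl, fun _ => rfl⟩
  | mul u v _ _ hu hv =>
    refine ⟨?_, ?_, ?_, ?_, fun h => ?_⟩ <;>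
      simp_all [mul_a, mul_b, mul_c, mul_d, mul_e, zero_carry]
  | inv u _ hu =>
    refine ⟨?_, ?_, ?_, ?_, fun h => ?_⟩ <;>
      simp_all [inv_a, inv_b, inv_c, inv_d, inv_e, zero_carry]

theorem pSeries_four : pSeries p (Model p x y s t) 4 = ⊥ := by
  refine (Subgroup.closure_eq_bot_iff).2 ?_
  rintro u ⟨h, hh, k, hk, g, rfl⟩
  rw [Set.mem_singleton_iff]
  ext <;> simp [mul_a, mul_b, mul_c, mul_d, mul_e, comm_eq, pow_prime, mem_pSeries_three hh,
    mem_pSeries_three hk, one_a, one_b, one_c, one_d, one_e, zero_carry]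

end Model

theorem comm_mem_pSeries {G : Type*} [Group G] {p i : ℕ} {h : G} (hh : h ∈ pSeries p G i) (g : G) :
    comm h g ∈ pSeries p G (i + 1) :=
  Subgroup.subset_closure ⟨h, hh, 1, one_mem _, g, by simp⟩

theorem pow_mem_pSeries {G : Type*} [Group G] {p i : ℕ} {k : G} (hk : k ∈ pSeries p G i) :
    k ^ p ∈ pSeries p G (i + 1) :=
  Subgroup.subset_closure ⟨1, one_mem _, k, hk, 1, by simp [comm]⟩

theorem pSeries_succ_eq_bot {G : Type*} [Group G] {p i : ℕ} (hi : pSeries p G i = ⊥) :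
    pSeries p G (i + 1) = ⊥ := by
  refine (Subgroup.closure_eq_bot_iff).2 ?_
  rintro u ⟨h, hh, k, hk, g, rfl⟩
  rw [hi, Subgroup.mem_bot] at hh hk
  simp [hh, hk, comm]

theorem pSeries_eq_bot_of_le {G : Type*} [Group G] {p i j : ℕ} (hij : i ≤ j)
    (hi : pSeries p G i = ⊥) : pSeries p G j = ⊥ := by
  induction hij with
  | refl => exact hi
  | step _ ih => exact pSeries_succ_eq_bot ih

theorem hasPClass_succ {G : Type*} [Group G] {p i : ℕ} :
    HasPClass p G (i + 1) ↔ pSeries p G (i + 1) = ⊥ ∧ pSeries p G i ≠ ⊥ := by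
  constructor
  · rintro ⟨h1, h2⟩
    exact ⟨h1, fun h => absurd (h2 h) (by omega)⟩
  · rintro ⟨h1, h2⟩
    refine ⟨h1, fun j hj => ?_⟩
    by_contra hlt
    exact h2 (pSeries_eq_bot_of_le (by omega) hj)

/-- The series is compatible with surjective homomorphisms. -/
theorem map_pSeries {G H : Type*} [Group G] [Group H] (p : ℕ) (f : G →* H)
    (hf : Function.Surjective f) (i : ℕ) : (pSeries p G i).map f = pSeries p H i := by
  induction i with
  | zero => exact Subgroup.map_top_of_surjective f hf
  | succ i ih =>
    refine (MonoidHom.map_closure f _).trans (congrArg Subgroup.closure ?_)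
    ext u
    constructor
    · rintro ⟨_, ⟨h, hh, k, hk, g, rfl⟩, rfl⟩
      refine ⟨f h, ih ▸ Subgroup.mem_map_of_mem f hh, f k, ih ▸ Subgroup.mem_map_of_mem f hk, f g,
        ?_⟩
      rw [map_mul, map_pow, map_comm]
    · rintro ⟨h, hh, k, hk, g, rfl⟩
      rw [← ih] at hh hk
      obtain ⟨h, hh, rfl⟩ := hh
      obtain ⟨k, hk, rfl⟩ := hk
      obtain ⟨g, rfl⟩ := hf g
      exact ⟨_, ⟨h, hh, k, hk, g, rfl⟩, by rw [map_mul, map_pow, map_comm]⟩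

theorem map_pSeries_mulEquiv {G H : Type*} [Group G] [Group H] (p : ℕ) (f : G ≃* H) (i : ℕ) :
    (pSeries p G i).map (f : G →* H) = pSeries p H i :=
  map_pSeries p _ f.surjective i

theorem pSeries_eq_bot_congr {G H : Type*} [Group G] [Group H] (p : ℕ) (f : G ≃* H) (i : ℕ) :
    pSeries p G i = ⊥ ↔ pSeries p H i = ⊥ := by
  rw [← map_pSeries_mulEquiv p f i, Subgroup.map_eq_bot_iff_of_injective _ f.injective]

theorem hasPClass_congr {G H : Type*} [Group G] [Group H] {p c : ℕ} (f : G ≃* H) :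
    HasPClass p G c ↔ HasPClass p H c := by
  unfold HasPClass
  simp only [pSeries_eq_bot_congr p f]

theorem IsImmediateDescendant.congr {p : ℕ} {G H K : Type*} [Group G] [Group H] [Group K]
    [Group.FG G] [Group.FG H] [Group.FG K] (h : IsImmediateDescendant p G H) (f : H ≃* K) :
    IsImmediateDescendant p G K := by
  obtain ⟨c, h1, ⟨h2⟩, h3⟩ := h.exists_pClass
  have := h.finite
  exact ⟨h.finite_base, h.isPGroup_base, Finite.of_equiv _ f.toEquiv, h.isPGroup.of_equiv f,
    (Group.rank_congr f).symm.trans h.rank_eq, c, h1,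
    ⟨(QuotientGroup.congr _ _ f (map_pSeries_mulEquiv p f c)).symm.trans h2⟩,
    (hasPClass_congr f).1 h3⟩

namespace Model

variable {p : ℕ} [Fact p.Prime] {x y s t : ZMod p}


/-- The iterated commutators of the second standard generator with the first; they show that the
series does not drop too early. -/
theorem standard_mem_pSeries :
    (⟨0, 0, 2, 6, 4 * x + 12 * y⟩ : Model p x y s t) ∈ pSeries p (Model p x y s t) 1 ∧
    (⟨0, 0, 0, 12, 24 * x⟩ : Model p x y s t) ∈ pSeries p (Model p x y s t) 2 ∧
    (⟨0, 0, 0, 0, 24 * x⟩ : Model p x y s t) ∈ pSeries p (Model p x y s t) 3 := by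
  have h1 : (⟨0, 0, 2, 6, 4 * x + 12 * y⟩ : Model p x y s t) ∈
      pSeries p (Model p x y s t) 1 := by
    have h0 : (⟨0, 1, 0, 0, 0⟩ : Model p x y s t) ∈ pSeries p (Model p x y s t) 0 :=
      Subgroup.mem_top _
    convert comm_mem_pSeries h0 ⟨1, 0, 0, 0, 0⟩ using 1
    ext <;> simp [comm_eq]
    ring
  have h2 : (⟨0, 0, 0, 12, 24 * x⟩ : Model p x y s t) ∈ pSeries p (Model p x y s t) 2 := by
    convert comm_mem_pSeries h1 ⟨1, 0, 0, 0, 0⟩ using 1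
    ext <;> simp [comm_eq] <;> ring
  refine ⟨h1, h2, ?_⟩
  convert comm_mem_pSeries h2 ⟨1, 0, 0, 0, 0⟩ using 1
  ext <;> simp [comm_eq]
  ring

theorem layer₅_mem_pSeries (hp : 3 < p) (hx : x ≠ 0) (e : ZMod p) :
    (⟨0, 0, 0, 0, e⟩ : Model p x y s t) ∈ pSeries p (Model p x y s t) 3 :=
  mem_of_layer₅ (mul_ne_zero (twentyfour_ne_zero' hp) hx) standard_mem_pSeries.2.2 e

theorem pSeries_three_ne_bot_iff (hp : 3 < p) : pSeries p (Model p x y s t) 3 ≠ ⊥ ↔ x ≠ 0 := by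
  constructor
  · rintro h rfl
    refine h ((Subgroup.eq_bot_iff_forall _).2 fun u hu => ?_)
    obtain ⟨h1, h2, h3, h4, h5⟩ := mem_pSeries_three hu
    ext <;> simp [h1, h2, h3, h4, h5, one_a, one_b, one_c, one_d, one_e]
  · intro hx h
    have := layer₅_mem_pSeries (y := y) (s := s) (t := t) hp hx 1
    rw [h, Subgroup.mem_bot] at this
    exact one_ne_zero (congrArg Model.e this)

theorem card_pSeries_three_le : Nat.card (pSeries p (Model p x y s t) 3) ≤ p := by
  have hf : Function.Injective (fun u : pSeries p (Model p x y s t) 3 => u.1.e) := by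
    rintro ⟨u, hu⟩ ⟨v, hv⟩ huv
    have h1 := mem_pSeries_three hu
    have h2 := mem_pSeries_three hv
    exact Subtype.ext (Model.ext (h1.1.trans h2.1.symm) (h1.2.1.trans h2.2.1.symm)
      (h1.2.2.1.trans h2.2.2.1.symm) (h1.2.2.2.1.trans h2.2.2.2.1.symm) huv)
  have := Nat.card_le_card_of_injective _ hf
  rwa [Nat.card_zmod] at this

theorem le_card_quotient : p ^ 4 ≤ Nat.card (Model p x y s t ⧸ pSeries p (Model p x y s t) 3) := by
  have h := Subgroup.card_eq_card_quotient_mul_card_subgroup (pSeries p (Model p x y s t) 3)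
  rw [card_eq] at h
  have h2 := card_pSeries_three_le (x := x) (y := y) (s := s) (t := t)
  have hp : 0 < p := (Fact.out : p.Prime).pos
  refine Nat.le_of_mul_le_mul_right ?_ hp
  calc p ^ 4 * p = _ := (pow_succ p 4).symm.trans h
    _ ≤ _ := Nat.mul_le_mul_left _ h2

/-- The standard generators of the model. -/
theorem exists_extRel (hp : 3 < p) (x y s t : ZMod p) : ∃ g₁ g₂ g₃ g₄ g₅ : Model p x y s t,
    ExtRel p x.val y.val s.val t.val g₁ g₂ g₃ g₄ g₅ ∧
    Subgroup.closure {g₁, g₂, g₃, g₄, g₅} = ⊤ ∧ g₅ = ⟨0, 0, 0, 0, 24⟩ := by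
  have h : ∀ z : ZMod p, z = 1 * ((z.val : ℕ) : ZMod p) := fun z => by simp
  refine ⟨_, _, _, _, _, extRel (α := 1) (β := 0) (δ := 1) (l := 1) ?_ ?_ ?_ ?_,
    closure_generators_eq_top hp one_ne_zero one_ne_zero one_ne_zero, by simp⟩ <;> simp

end Model

theorem ExtRel.baseRel {X : Type*} [Group X] {p x y s t : ℕ} {g₁ g₂ g₃ g₄ g₅ : X}
    (R : ExtRel p x y s t g₁ g₂ g₃ g₄ g₅) {Y : Type*} [Group Y] (f : X →* Y) (hf : f g₅ = 1) :
    BaseRel p (f g₁) (f g₂) (f g₃) (f g₄) := by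
  constructor <;> simp only [← map_comm, ← map_pow, R.pow₁, R.pow₂, R.pow₃, R.pow₄, R.com₂₁,
    R.com₃₁, R.com₄₁, R.com₃₂, R.com₄₂, R.com₄₃, map_one] <;> simp only [map_pow, hf, one_pow]

namespace Model

variable {p : ℕ} [Fact p.Prime] {x y s t : ZMod p}

/-- The images of the standard generators give a surjection from the base group. Its order is at
most `p ^ 4` and the quotient has at least that many elements, so it is bijective. -/
theorem nonempty_baseGroup_mulEquiv (hp : 3 < p) (hx : x ≠ 0) :
    Nonempty (BaseGroup p ≃* Model p x y s t ⧸ pSeries p (Model p x y s t) 3) := by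
  obtain ⟨g₁, g₂, g₃, g₄, g₅, R, hg, h₅⟩ := exists_extRel hp x y s t
  let π := QuotientGroup.mk' (pSeries p (Model p x y s t) 3)
  have hπ : π g₅ = 1 := (QuotientGroup.eq_one_iff _).2 (h₅ ▸ layer₅_mem_pSeries hp hx 24)
  obtain ⟨f, hf⟩ := exists_baseGroup_hom (R.baseRel π hπ) (by
    rw [eq_top_iff, ← Subgroup.map_top_of_surjective π (QuotientGroup.mk'_surjective _), ← hg,
      MonoidHom.map_closure, Subgroup.closure_le]
    rintro _ ⟨u, (rfl | rfl | rfl | rfl | rfl), rfl⟩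
    · exact Subgroup.subset_closure (by simp)
    · exact Subgroup.subset_closure (by simp)
    · exact Subgroup.subset_closure (by simp)
    · exact Subgroup.subset_closure (by simp)
    · rw [hπ]; exact one_mem _)
  obtain ⟨hfin, hle⟩ := baseGroup_finite_card_le (p := p) (by omega)
  exact nonempty_mulEquiv_of_surjective f hf (hle.trans le_card_quotient)

end Model

/-! ### The base group, and the models as its descendants. -/

section

variable {p : ℕ} [Fact p.Prime]

theorem card_baseGroup (hp : 3 < p) : Nat.card (BaseGroup p) = p ^ 4 := by
  obtain ⟨f⟩ := Model.nonempty_baseGroup_mulEquiv (x := 1) (y := 0) (s := 0) (t := 0) hp one_ne_zero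
  refine le_antisymm (baseGroup_finite_card_le (by omega)).2 ?_
  rw [Nat.card_congr f.toEquiv]
  exact Model.le_card_quotient

theorem hasPClass_baseGroup (hp : 3 < p) : HasPClass p (BaseGroup p) 3 := by
  obtain ⟨f⟩ := Model.nonempty_baseGroup_mulEquiv (x := 1) (y := 0) (s := 0) (t := 0) hp one_ne_zero
  rw [hasPClass_congr f, hasPClass_succ]
  have hsurj := QuotientGroup.mk'_surjective (pSeries p (Model p 1 0 0 0) 3)
  refine ⟨?_, fun h => ?_⟩
  · rw [← map_pSeries p _ hsurj]
    exact QuotientGroup.map_mk'_self _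
  -- The second term of the model contains an element with `d = 12`, which cannot lie in the third
  -- term.
  · rw [← map_pSeries p _ hsurj, (Subgroup.map_eq_bot_iff), QuotientGroup.ker_mk'] at h
    have h12 := (Model.mem_pSeries_three (h (Model.standard_mem_pSeries.2.1))).2.2.2.1
    exact Model.twelve_ne_zero' hp h12

theorem baseGroup_not_commutative (hp : 3 < p) : ∃ g h : BaseGroup p, g * h ≠ h * g := by
  obtain ⟨f⟩ := Model.nonempty_baseGroup_mulEquiv (x := 1) (y := 0) (s := 0) (t := 0) hp one_ne_zero
  let π := QuotientGroup.mk' (pSeries p (Model p 1 0 0 0) 3)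
  refine ⟨f.symm (π ⟨0, 1, 0, 0, 0⟩), f.symm (π ⟨1, 0, 0, 0, 0⟩), fun h => ?_⟩
  rw [← comm_eq_one_iff, ← map_comm, ← map_comm, map_eq_one_iff _ f.symm.injective] at h
  have h1 := (Model.mem_pSeries_three ((QuotientGroup.eq_one_iff _).1 h)).2.2.1
  simp only [Model.comm_eq] at h1
  exact Model.two_ne_zero' hp (by simpa using h1)

/-- A group that is not commutative needs at least two generators. -/
theorem two_le_rank {X : Type*} [Group X] [Group.FG X] (h : ∃ g h : X, g * h ≠ h * g) :
    2 ≤ Group.rank X := by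
  by_contra! hlt
  obtain ⟨S, hS, hcl⟩ := Group.rank_spec X
  obtain ⟨a, ha⟩ : ∃ a : X, (S : Set X) ⊆ {a} := by
    rcases Nat.lt_or_ge S.card 1 with h0 | h1
    · exact ⟨1, by simp [Finset.card_eq_zero.1 (by omega : S.card = 0)]⟩
    · obtain ⟨a, ha⟩ := Finset.card_eq_one.1 (by omega : S.card = 1)
      exact ⟨a, by simp [ha]⟩
  have hz : ∀ g, g ∈ Subgroup.zpowers a := fun g => by
    have := Subgroup.closure_mono ha (hcl ▸ Subgroup.mem_top g)
    rwa [← Subgroup.zpowers_eq_closure] at this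
  obtain ⟨g, k, hgk⟩ := h
  obtain ⟨m, rfl⟩ := hz g
  obtain ⟨n, rfl⟩ := hz k
  exact hgk ((Commute.refl a).zpow_zpow m n)

theorem Model.rank_le_two {x y s t : ZMod p} (hp : 3 < p) (hx : x ≠ 0) :
    Group.rank (Model p x y s t) ≤ 2 := by
  classical
  let g₁ : Model p x y s t := ⟨1, 0, 0, 0, 0⟩
  let g₂ : Model p x y s t := ⟨0, 1, 0, 0, 0⟩
  let K := Subgroup.closure (({g₁, g₂} : Finset (Model p x y s t)) : Set (Model p x y s t))
  have h₁ : g₁ ∈ K := Subgroup.subset_closure (by simp)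
  have h₂ : g₂ ∈ K := Subgroup.subset_closure (by simp)
  have hc : ∀ {g h}, g ∈ K → h ∈ K → comm g h ∈ K := fun hg hh =>
    K.mul_mem (K.mul_mem (K.mul_mem (K.inv_mem hg) (K.inv_mem hh)) hg) hh
  have h₅ : (⟨0, 0, 0, 0, 24 * x⟩ : Model p x y s t) ∈ K := by
    convert hc (hc (hc h₂ h₁) h₁) h₁ using 1
    ext <;> simp [comm_eq, g₁, g₂]
    ring
  have hK : K = ⊤ := by
    refine closure_eq_top h₁ ?_ h₂ ?_ ?_ (hc h₂ h₁) ?_ ?_ ?_ (hc (hc h₂ h₁) h₁) ?_ ?_ ?_ ?_ h₅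
      (mul_ne_zero (twentyfour_ne_zero' hp) hx)
    all_goals simp [comm_eq, g₁, g₂, two_ne_zero' hp, six_ne_zero' hp]
  exact (Group.rank_le hK).trans Finset.card_le_two

/-- Both ranks equal 2: the base group is a noncommutative quotient of the model, and the model has
two generators. -/
theorem Model.isImmediateDescendant {x y s t : ZMod p} (hp : 3 < p) (hx : x ≠ 0) :
    IsImmediateDescendant p (BaseGroup p) (Model p x y s t) := by
  obtain ⟨f⟩ := nonempty_baseGroup_mulEquiv (y := y) (s := s) (t := t) hp hx
  have h1 : Group.rank (BaseGroup p) ≤ Group.rank (Model p x y s t) :=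
    Group.rank_le_of_surjective
      ((f.symm : _ →* BaseGroup p).comp (QuotientGroup.mk' (pSeries p (Model p x y s t) 3)))
      (f.symm.surjective.comp (QuotientGroup.mk'_surjective _))
  have h2 := two_le_rank (baseGroup_not_commutative hp)
  have h3 := rank_le_two (y := y) (s := s) (t := t) hp hx
  exact ⟨(baseGroup_finite_card_le (by omega)).1, IsPGroup.of_card (card_baseGroup hp),
    inferInstance, IsPGroup.of_card card_eq, by omega, 3, hasPClass_baseGroup hp, ⟨f.symm⟩,
    hasPClass_succ.2 ⟨pSeries_four, (pSeries_three_ne_bot_iff hp).2 hx⟩⟩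

end

end PDesc

/-! ### Every descendant of order `p ^ 5` is a model. -/

namespace PDesc

section

variable {H : Type*} [Group H]

/-- Collection: moving `h` to the left past `g ^ n` creates `c ^ n`, and these exponents sum to a
binomial coefficient. -/
theorem mul_pow_of_comm_central {g h c : H} (hc : g * h = h * g * c) (hcg : Commute c g)
    (hch : Commute c h) (n : ℕ) : (h * g) ^ n = h ^ n * g ^ n * c ^ (n.choose 2) := by
  have key : ∀ n : ℕ, g ^ n * h = h * g ^ n * c ^ n := by
    intro n
    induction n with
    | zero => simp
    | succ n ih =>
      rw [pow_succ, mul_assoc, hc, ← mul_assoc, ← mul_assoc, ih, pow_succ c]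
      rw [mul_assoc (h * g ^ n), (hcg.pow_left n).eq]
      simp only [mul_assoc]
  induction n with
  | zero => simp
  | succ n ih =>
    have h1 : c ^ n.choose 2 * (h * g) = h * g * c ^ n.choose 2 :=
      ((hch.mul_right hcg).pow_left _).eq
    have h2 : c ^ n * g = g * c ^ n := (hcg.pow_left n).eq
    rw [pow_succ, ih, mul_assoc, h1, ← mul_assoc, ← mul_assoc, mul_assoc (h ^ n), key n,
      Nat.choose_succ_succ' n 1, Nat.choose_one_right, pow_succ h n, pow_succ g n, pow_add]
    simp only [mul_assoc]
    rw [← mul_assoc (c ^ n) g, h2, mul_assoc]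

/-- If `[h, g]` and `[h', g]` are central then the commutator with `g` is multiplicative. -/
theorem comm_mul_left_of_central {h h' g : H} (hc : ∀ k, Commute (comm h g) k) :
    comm (h * h') g = comm h g * comm h' g := by
  have : comm (h * h') g = h'⁻¹ * comm h g * h' * comm h' g := by simp only [comm]; group
  rw [this, mul_assoc h'⁻¹, (hc h').eq, inv_mul_cancel_left]

theorem comm_mul_right_of_central {h g g' : H} (hc : ∀ k, Commute (comm h g) k) :
    comm h (g * g') = comm h g * comm h g' := by
  have : comm h (g * g') = comm h g' * (g'⁻¹ * comm h g * g') := by simp only [comm]; group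
  rw [this, mul_assoc g'⁻¹, (hc g').eq, inv_mul_cancel_left, (hc _).eq]

theorem inv_mul_mul_eq (h g : H) : g⁻¹ * h * g = h * comm h g := by
  simp only [comm]; group

theorem comm_conj (h k g : H) :
    comm (g⁻¹ * h * g) (g⁻¹ * k * g) = g⁻¹ * comm h k * g := by
  simp only [comm]; group

/-- A lift of the generators of the base group to a central extension by a group of order `p`
satisfies the relations of an extension. -/
theorem exists_extRel_of_central {p : ℕ} [Fact p.Prime] (hp : 2 < p) {z : H} (hz : z ^ p = 1)
    (hcen : ∀ g, Commute z g) {g₁ g₂ : H}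
    (hx : comm (comm (comm g₂ g₁) g₁) g₁ ∈ Subgroup.zpowers z)
    (hy : comm (comm g₂ g₁) g₂ ∈ Subgroup.zpowers z)
    (h42 : comm (comm (comm g₂ g₁) g₁) g₂ ∈ Subgroup.zpowers z)
    (hp₁ : g₁ ^ p ∈ Subgroup.zpowers z) (hp₂ : g₂ ^ p ∈ Subgroup.zpowers z)
    (hp₃ : comm g₂ g₁ ^ p ∈ Subgroup.zpowers z) :
    ∃ x y s t : ℕ, ExtRel p x y s t g₁ g₂ (comm g₂ g₁) (comm (comm g₂ g₁) g₁) z := by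
  have hpp : 0 < p := (Fact.out : p.Prime).pos
  have hcz : ∀ {u : H}, u ∈ Subgroup.zpowers z → ∀ g, Commute u g := by
    rintro _ ⟨k, rfl⟩ g
    exact (hcen g).zpow_left k
  have hnat : ∀ {u : H}, u ∈ Subgroup.zpowers z → ∃ n : ℕ, u = z ^ n := by
    intro u hu
    have hfin : IsOfFinOrder z := isOfFinOrder_iff_pow_eq_one.2 ⟨p, hpp, hz⟩
    obtain ⟨n, hn⟩ := (hfin.mem_powers_iff_mem_zpowers).2 hu
    exact ⟨n, hn.symm⟩
  have hpow : ∀ {u : H}, u ∈ Subgroup.zpowers z → u ^ p = 1 := by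
    intro u hu
    obtain ⟨n, rfl⟩ := hnat hu
    rw [← pow_mul, mul_comm, pow_mul, hz, one_pow]
  generalize e₃ : comm g₂ g₁ = g₃ at *
  generalize e₄ : comm g₃ g₁ = g₄ at *
  -- Since `g₁ g₂ g₃ = g₂ g₁` and the commutators of `g₄` with `g₁` and `g₂` are central, expanding
  -- `[g₄, ·]` on both sides leaves only `[g₄, g₃]`.
  have c43 : comm g₄ g₃ = 1 := by
    have h := congrArg (comm g₄) (mul_comm_comm g₂ g₁)
    rw [e₃, comm_mul_right_of_central (g' := g₃) (by
        rw [comm_mul_right_of_central (hcz hx)]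
        exact fun k => (hcz hx k).mul_left (hcz h42 k)),
      comm_mul_right_of_central (hcz hx), comm_mul_right_of_central (hcz h42),
      (hcz hx _).eq] at h
    exact mul_eq_left.1 h
  -- Conjugation by `g₁` fixes the central `[g₃, g₂]` and sends `g₃` to `g₃ g₄` and `g₂` to `g₂ g₃`;
  -- expanding leaves `[g₄, g₂]`.
  have c42 : comm g₄ g₂ = 1 := by
    have h := comm_conj g₃ g₂ g₁
    rw [inv_mul_mul_eq, inv_mul_mul_eq, e₃, e₄, mul_assoc, (hcz hy g₁).eq,
      inv_mul_cancel_left] at h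
    have h32 : comm g₃ (g₂ * g₃) = comm g₃ g₂ := by
      rw [comm_mul_right_of_central (hcz hy), comm_eq_one_iff.2 rfl, mul_one]
    rw [comm_mul_left_of_central (by rw [h32]; exact hcz hy), h32,
      comm_mul_right_of_central (hcz h42), c43, mul_one] at h
    exact mul_eq_left.1 h
  -- Conjugating the central `g₃ ^ p` by `g₁` gives `(g₃ g₄) ^ p = g₃ ^ p`, with commuting factors.
  have p₄ : g₄ ^ p = 1 := by
    have h : (g₁⁻¹ * g₃ * g₁) ^ p = g₁⁻¹ * g₃ ^ p * g₁ := by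
      have := conj_pow (i := p) (a := g₁⁻¹) (b := g₃)
      rwa [inv_inv] at this
    rw [inv_mul_mul_eq, e₄, mul_assoc, (hcz hp₃ g₁).eq, inv_mul_cancel_left,
      Commute.mul_pow (comm_eq_one_iff.1 c43).symm] at h
    exact mul_eq_left.1 h
  -- Likewise `(g₂ g₃) ^ p = g₂ ^ p`; the collection term dies because `p` divides `p.choose 2` for
  -- odd `p`.
  have p₃ : g₃ ^ p = 1 := by
    have h : (g₁⁻¹ * g₂ * g₁) ^ p = g₁⁻¹ * g₂ ^ p * g₁ := by
      have := conj_pow (i := p) (a := g₁⁻¹) (b := g₂)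
      rwa [inv_inv] at this
    have hch : p ∣ p.choose 2 := (Fact.out : p.Prime).dvd_choose_self (by norm_num) hp
    obtain ⟨m, hm⟩ := hch
    rw [inv_mul_mul_eq, e₃, mul_assoc, (hcz hp₂ g₁).eq, inv_mul_cancel_left,
      mul_pow_of_comm_central (mul_comm_comm g₃ g₂).symm (hcz hy _) (hcz hy _), hm, pow_mul,
      hpow hy, one_pow, mul_one] at h
    exact mul_eq_left.1 h
  obtain ⟨x, hx⟩ := hnat hx
  obtain ⟨y, hy⟩ := hnat hy
  obtain ⟨s, hs⟩ := hnat hp₁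
  obtain ⟨t, ht⟩ := hnat hp₂
  exact ⟨x, y, s, t, hs, ht, p₃, p₄, hz, e₃, e₄, hx, comm_eq_one_iff.2 (hcen _), hy, c42,
    comm_eq_one_iff.2 (hcen _), c43, comm_eq_one_iff.2 (hcen _), comm_eq_one_iff.2 (hcen _)⟩

/-- Every immediate descendant of order `p ^ 5` is isomorphic to one of the models. -/
theorem exists_model_mulEquiv {p : ℕ} [Fact p.Prime] (hp : 3 < p) (hcard : Nat.card H = p ^ 5)
    [Group.FG H] (hH : IsImmediateDescendant p (BaseGroup p) H) :
    ∃ x y s t : ZMod p, x ≠ 0 ∧ Nonempty (H ≃* Model p x y s t) := by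
  have hpp : 0 < p := (Fact.out : p.Prime).pos
  obtain ⟨c, hc, ⟨f⟩, hcl⟩ := hH.exists_pClass
  obtain rfl : c = 3 := hc.unique (hasPClass_baseGroup hp)
  have hfin := hH.finite
  have hγ : Nat.card (pSeries p H 3) = p := by
    have h := Subgroup.card_eq_card_quotient_mul_card_subgroup (pSeries p H 3)
    rw [hcard, Nat.card_congr f.toEquiv, card_baseGroup hp, pow_succ p 4] at h
    exact (Nat.eq_of_mul_eq_mul_left (pow_pos hpp 4) h).symm
  obtain ⟨h4, h3⟩ := hasPClass_succ.1 hcl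
  obtain ⟨z, hz⟩ : ∃ z : H, Subgroup.zpowers z = pSeries p H 3 := by
    have := isCyclic_of_prime_card hγ
    obtain ⟨⟨z, hz⟩, hgen⟩ := IsCyclic.exists_generator (α := pSeries p H 3)
    refine ⟨z, le_antisymm ((Subgroup.zpowers_le).2 hz) fun u hu => ?_⟩
    obtain ⟨k, hk⟩ := hgen ⟨u, hu⟩
    exact ⟨k, congrArg Subtype.val hk⟩
  have hz3 : z ∈ pSeries p H 3 := hz ▸ Subgroup.mem_zpowers z
  have hcen : ∀ g, Commute z g := fun g => by
    have := comm_mem_pSeries hz3 g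
    rw [h4, Subgroup.mem_bot] at this
    exact comm_eq_one_iff.1 this
  have hzp : z ^ p = 1 := by
    have := pow_mem_pSeries hz3
    rwa [h4, Subgroup.mem_bot] at this
  let π : H →* BaseGroup p := (f : _ →* BaseGroup p).comp (QuotientGroup.mk' (pSeries p H 3))
  have hπ : ∀ u, π u = 1 ↔ u ∈ Subgroup.zpowers z := fun u => by
    rw [hz]
    exact (map_eq_one_iff f f.injective).trans (QuotientGroup.eq_one_iff u)
  have hsurj : Function.Surjective π := f.surjective.comp (QuotientGroup.mk'_surjective _)
  have R := baseGroup_rel p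
  obtain ⟨g₁, hg₁⟩ := hsurj (PresentedGroup.of 0)
  obtain ⟨g₂, hg₂⟩ := hsurj (PresentedGroup.of 1)
  have hg₃ : π (comm g₂ g₁) = PresentedGroup.of 2 := by rw [map_comm, hg₁, hg₂, R.com₂₁]
  have hg₄ : π (comm (comm g₂ g₁) g₁) = PresentedGroup.of 3 := by
    rw [map_comm, hg₁, hg₃, R.com₃₁]
  obtain ⟨x, y, s, t, hR⟩ := exists_extRel_of_central (by omega) hzp hcen
    ((hπ _).1 (by rw [map_comm, hg₄, hg₁, R.com₄₁]))
    ((hπ _).1 (by rw [map_comm, hg₃, hg₂, R.com₃₂]))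
    ((hπ _).1 (by rw [map_comm, hg₄, hg₂, R.com₄₂]))
    ((hπ _).1 (by rw [map_pow, hg₁, R.pow₁]))
    ((hπ _).1 (by rw [map_pow, hg₂, R.pow₂]))
    ((hπ _).1 (by rw [map_pow, hg₃, R.pow₃]))
  have hgen : Subgroup.closure {g₁, g₂, comm g₂ g₁, comm (comm g₂ g₁) g₁, z} = ⊤ := by
    set K := Subgroup.closure {g₁, g₂, comm g₂ g₁, comm (comm g₂ g₁) g₁, z}
    have hzK : Subgroup.zpowers z ≤ K :=
      (Subgroup.zpowers_le).2 (Subgroup.subset_closure (by simp))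
    have hmap : K.map π = ⊤ := by
      rw [eq_top_iff, ← PresentedGroup.closure_range_of, Subgroup.closure_le]
      rintro _ ⟨i, rfl⟩
      fin_cases i
      · exact ⟨g₁, Subgroup.subset_closure (by simp), hg₁⟩
      · exact ⟨g₂, Subgroup.subset_closure (by simp), hg₂⟩
      · exact ⟨_, Subgroup.subset_closure (by simp), hg₃⟩
      · exact ⟨_, Subgroup.subset_closure (by simp), hg₄⟩
    rw [eq_top_iff]
    intro u _
    obtain ⟨k, hk, hku⟩ : π u ∈ K.map π := hmap ▸ Subgroup.mem_top _
    have : k⁻¹ * u ∈ K := hzK ((hπ _).1 (by rw [map_mul, map_inv, hku, inv_mul_cancel]))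
    simpa using K.mul_mem hk this
  obtain ⟨e₁⟩ := nonempty_extGroup_mulEquiv hpp hR hgen hcard
  obtain ⟨e₂⟩ := Model.nonempty_extGroup_mulEquiv_natCast hp x y s t
  -- The parameter `x` is nonzero because the third series term of `H` is nontrivial.
  refine ⟨x, y, s, t, (Model.pSeries_three_ne_bot_iff (y := y) (s := s) (t := t) hp).1 ?_,
    ⟨e₁.symm.trans e₂⟩⟩
  rwa [Ne, ← pSeries_eq_bot_congr p (e₁.symm.trans e₂)]

end
end PDesc

/-! ### Isomorphisms force a change of generators. -/

namespace PDesc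

theorem ExtRel.map {X Y : Type*} [Group X] [Group Y] {p x y s t : ℕ} {g₁ g₂ g₃ g₄ g₅ : X}
    (R : ExtRel p x y s t g₁ g₂ g₃ g₄ g₅) (f : X →* Y) :
    ExtRel p x y s t (f g₁) (f g₂) (f g₃) (f g₄) (f g₅) := by
  constructor <;> simp only [← map_comm, ← map_pow, R.pow₁, R.pow₂, R.pow₃, R.pow₄, R.pow₅,
    R.com₂₁, R.com₃₁, R.com₄₁, R.com₅₁, R.com₃₂, R.com₄₂, R.com₅₂, R.com₄₃, R.com₅₃, R.com₅₄,
    map_one]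

namespace Model

variable {p : ℕ} [Fact p.Prime] {x y s t x' y' s' t' : ZMod p}

/-- The parameters of isomorphic models are related by a change of generators. -/
theorem exists_change_of_generators (hp : 3 < p) (hx : x ≠ 0)
    (φ : Model p x y s t ≃* Model p x' y' s' t') :
    ∃ α β δ l : ZMod p, α ≠ 0 ∧ δ ≠ 0 ∧ l ≠ 0 ∧ x' * α ^ 3 * δ = l * x ∧
      y' * α * δ ^ 2 = l * y ∧ s' * α + t' * β = l * s ∧ t' * δ = l * t := by
  have h24 := twentyfour_ne_zero' hp
  obtain ⟨g₁, g₂, g₃, g₄, g₅, R, -, h₅⟩ := exists_extRel hp x y s t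
  have hg₅ : g₅ ≠ 1 := fun h => h24 (by rw [h] at h₅; exact (congrArg Model.e h₅).symm)
  have hm : φ g₅ ∈ pSeries p (Model p x' y' s' t') 3 := by
    rw [← map_pSeries_mulEquiv p φ 3]
    exact Subgroup.mem_map_of_mem _ (h₅ ▸ layer₅_mem_pSeries hp hx 24)
  have R' := R.map (φ : _ →* Model p x' y' s' t')
  simp only [MonoidHom.coe_coe] at R'
  obtain ⟨ha, hb, hc, hd, -⟩ := mem_pSeries_three hm
  obtain ⟨l, hl⟩ : ∃ l, φ g₅ = ⟨0, 0, 0, 0, 24 * l⟩ :=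
    ⟨(φ g₅).e / 24, Model.ext ha hb hc hd (mul_div_cancel₀ _ h24).symm⟩
  have hl0 : l ≠ 0 := by
    rintro rfl
    refine hg₅ ((map_eq_one_iff φ φ.injective).1 (hl.trans ?_))
    ext <;> simp [one_a, one_b, one_c, one_d, one_e]
  generalize φ g₁ = u at R'
  generalize φ g₂ = v at R'
  have hpow : ∀ z : ZMod p, (φ g₅ ^ z.val).e = 24 * (l * z) := by
    intro z
    rw [hl, pow_eq]
    simp
    ring
  have hpow' : ∀ n : ℕ, (φ g₅ ^ n).d = 0 := by
    intro n
    rw [hl, pow_eq]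
    simp
  have r₁ := congrArg Model.e R'.com₄₁
  have r₂ := congrArg Model.d R'.com₃₂
  have r₃ := congrArg Model.e R'.com₃₂
  have r₄ := congrArg Model.e R'.pow₁
  have r₅ := congrArg Model.e R'.pow₂
  rw [← R'.com₃₁, ← R'.com₂₁, hpow] at r₁
  rw [← R'.com₂₁, hpow'] at r₂
  rw [← R'.com₂₁, hpow] at r₃
  rw [hpow, pow_prime] at r₄ r₅
  simp only [comm_eq] at r₁ r₂ r₃
  have q₁ : x' * (v.b * u.a - v.a * u.b) * u.a ^ 2 = l * x := by
    refine mul_left_cancel₀ h24 ?_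
    linear_combination r₁
  -- The determinant of the induced map on the first two coordinates; if it vanished, so would `l *
  -- x`.
  have hD : v.b * u.a - v.a * u.b ≠ 0 := by
    intro h
    rw [h] at q₁
    exact mul_ne_zero hl0 hx (by rw [← q₁]; ring)
  -- The `d` coordinate of `[[v, u], v]` is 12 times the determinant times `v.a`, and it vanishes
  -- because that commutator is a power of the image of `g₅`. Hence the change of generators is
  -- triangular.
  have hv : v.a = 0 := by
    have : (12 * (v.b * u.a - v.a * u.b)) * v.a = 0 := by linear_combination r₂
    exact (mul_eq_zero.1 this).resolve_left (mul_ne_zero (twelve_ne_zero' hp) hD)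
  rw [hv] at q₁ r₃ r₅ hD
  have hu : u.a ≠ 0 := by rintro h; simp [h] at hD
  have hvb : v.b ≠ 0 := by rintro h; simp [h] at hD
  refine ⟨u.a, u.b, v.b, l, hu, hvb, hl0, ?_, ?_, ?_, ?_⟩
  · linear_combination q₁
  · refine mul_left_cancel₀ h24 ?_
    linear_combination r₃
  · exact mul_left_cancel₀ h24 r₄
  · refine mul_left_cancel₀ h24 ?_
    linear_combination r₅

end Model

/-! ### Orbits of the parameters. -/

section

variable {p : ℕ} [Fact p.Prime] {w : (ZMod p)ˣ}

theorem natCast_wPow (w : (ZMod p)ˣ) (a : ℕ) : ((wPow w a : ℕ) : ZMod p) = (w : ZMod p) ^ a :=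
  ZMod.natCast_zmod_val _

/-- Every unit is, up to a `k`-th power, one of the first `gcd k (p - 1)` powers of a generator. -/
theorem exists_mul_pow_eq (hw : ∀ x : (ZMod p)ˣ, x ∈ Subgroup.zpowers w) {k : ℕ} (hk : 0 < k)
    {u : ZMod p} (hu : u ≠ 0) :
    ∃ a : Fin (Nat.gcd k (p - 1)), ∃ α : ZMod p, α ≠ 0 ∧ u * α ^ k = (w : ZMod p) ^ (a : ℕ) := by
  obtain ⟨n, hn⟩ := hw (Units.mk0 u hu)
  have hg : 0 < Nat.gcd k (p - 1) := Nat.gcd_pos_of_pos_left _ hk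
  have hg' : ((Nat.gcd k (p - 1) : ℕ) : ℤ) ≠ 0 := by exact_mod_cast hg.ne'
  set g := Nat.gcd k (p - 1) with hgdef
  have hbez : (g : ℤ) = k * Nat.gcdA k (p - 1) + (p - 1 : ℕ) * Nat.gcdB k (p - 1) :=
    Nat.gcd_eq_gcd_ab k (p - 1)
  have h0 : 0 ≤ n % g := Int.emod_nonneg _ hg'
  have h1 : n % g < g := Int.emod_lt_of_pos _ (by exact_mod_cast hg)
  have hw1 : w ^ (p - 1) = 1 := ZMod.units_pow_card_sub_one_eq_one p w
  -- By Bézout, `k * gcdA` is `g` modulo `p - 1`, so `α ^ k` removes the multiple `g * (n / g)` from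
  -- the exponent `n`.
  let α : (ZMod p)ˣ := w ^ (-(Nat.gcdA k (p - 1) * (n / g)))
  refine ⟨⟨(n % g).toNat, by omega⟩, α, α.ne_zero, ?_⟩
  have key : Units.mk0 u hu * α ^ k = w ^ (n % g).toNat := by
    rw [← hn, ← zpow_natCast w (n % g).toNat, Int.toNat_of_nonneg h0, ← zpow_natCast α k,
      ← zpow_mul, ← zpow_add]
    have e : n + -(Nat.gcdA k (p - 1) * (n / g)) * k =
        n % g + (p - 1 : ℕ) * (Nat.gcdB k (p - 1) * (n / g)) := by
      have := Int.emod_add_mul_ediv n g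
      linear_combination (-1 : ℤ) * this + (n / g) * hbez
    rw [e, zpow_add, zpow_mul, zpow_natCast w (p - 1), hw1, one_zpow, mul_one]
  exact congrArg Units.val key

theorem eq_of_pow_mul_pow_eq (hw : ∀ x : (ZMod p)ˣ, x ∈ Subgroup.zpowers w) {k : ℕ}
    {a b : Fin (Nat.gcd k (p - 1))} {α : ZMod p} (hα : α ≠ 0)
    (h : (w : ZMod p) ^ (a : ℕ) * α ^ k = (w : ZMod p) ^ (b : ℕ)) : a = b := by
  obtain ⟨n, hn⟩ := hw (Units.mk0 α hα)
  have hord : orderOf w = p - 1 := by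
    rw [orderOf_eq_card_of_forall_mem_zpowers hw, Nat.card_eq_fintype_card, ZMod.card_units]
  have key : w ^ (a : ℕ) * Units.mk0 α hα ^ k = w ^ (b : ℕ) := Units.ext h
  have h1 : w ^ ((a : ℤ) + n * k - b) = 1 := by
    rw [zpow_sub, zpow_add, zpow_mul, zpow_natCast, zpow_natCast, zpow_natCast, ← key,
      show w ^ n = Units.mk0 α hα from hn, mul_inv_cancel]
  have h2 : ((p - 1 : ℕ) : ℤ) ∣ (a : ℤ) + n * k - b := by
    exact (congrArg Nat.cast hord.symm).dvd.trans (orderOf_dvd_iff_zpow_eq_one.2 h1)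
  have h3 : ((Nat.gcd k (p - 1) : ℕ) : ℤ) ∣ (a : ℤ) - b := by
    have h4 := (Int.natCast_dvd_natCast.2 (Nat.gcd_dvd_right k (p - 1))).trans h2
    have h5 : ((Nat.gcd k (p - 1) : ℕ) : ℤ) ∣ n * k :=
      (Int.natCast_dvd_natCast.2 (Nat.gcd_dvd_left k (p - 1))).mul_left n
    have := dvd_sub h4 h5
    rwa [show (a : ℤ) + n * k - b - n * k = a - b by ring] at this
  have h6 := Int.eq_zero_of_abs_lt_dvd h3 (by rw [abs_lt]; omega)
  ext
  omega

theorem nonempty_listedGroup_mulEquiv (hp : 3 < p) (w : (ZMod p)ˣ) (i : Index p) :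
    Nonempty (ListedGroup w i ≃* Model p ((exponents w i).1 : ℕ) ((exponents w i).2.1 : ℕ)
      ((exponents w i).2.2.1 : ℕ) ((exponents w i).2.2.2 : ℕ)) :=
  Model.nonempty_extGroup_mulEquiv_natCast hp _ _ _ _

theorem exponents_fst_ne_zero (w : (ZMod p)ˣ) (i : Index p) :
    (((exponents w i).1 : ℕ) : ZMod p) ≠ 0 := by
  cases i <;> simp [exponents, natCast_wPow]

theorem exists_listedGroup_mulEquiv (hp : 3 < p)
    (hw : ∀ x : (ZMod p)ˣ, x ∈ Subgroup.zpowers w) {x y s t : ZMod p} (hx : x ≠ 0) :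
    ∃ i : Index p, Nonempty (ListedGroup w i ≃* Model p x y s t) := by
  by_cases hy : y = 0
  · by_cases ht : t = 0
    · by_cases hs : s = 0
      · refine ⟨.G1, Model.nonempty_extGroup_mulEquiv hp (α := 1) (β := 0) (δ := 1) (l := x)
          one_ne_zero one_ne_zero hx ?_ ?_ ?_ ?_⟩ <;> simp [exponents, hy, hs, ht]
      · refine ⟨.G3, Model.nonempty_extGroup_mulEquiv hp (α := 1) (β := 0) (δ := s / x) (l := s)
          one_ne_zero (div_ne_zero hs hx) hs ?_ ?_ ?_ ?_⟩ <;> simp [exponents, hy, ht]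
        field_simp
    · obtain ⟨a, α, hα, ha⟩ := exists_mul_pow_eq hw (k := 3) (by norm_num) (div_ne_zero hx ht)
      -- The value of `β` makes `s' = 0` and `l = t δ` makes `t' = 1`. Then `x' = (x / t) α ^ 3`, so
      -- only cubes can be adjusted.
      refine ⟨.G2 a, Model.nonempty_extGroup_mulEquiv hp (α := α) (β := -(s * α / t)) (δ := 1)
          (l := t) hα one_ne_zero ht ?_ ?_ ?_ ?_⟩ <;> simp [exponents, hy, natCast_wPow]
      · rw [← ha]; field_simp
      · field_simp; ring
  · by_cases ht : t = 0
    · by_cases hs : s = 0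
      -- In the cases with `y ≠ 0`, `δ = x α ^ 2 / y` is the choice that gives `x' = y'`.
      · refine ⟨.G4, Model.nonempty_extGroup_mulEquiv hp (α := 1) (β := 0) (δ := x / y)
          (l := x ^ 2 / y) one_ne_zero (div_ne_zero hx hy) (div_ne_zero (pow_ne_zero 2 hx) hy)
          ?_ ?_ ?_ ?_⟩ <;> simp [exponents, hs, ht] <;> field_simp
      · obtain ⟨b, α, hα, hb⟩ := exists_mul_pow_eq hw (k := 4) (by norm_num)
          (div_ne_zero (pow_ne_zero 2 hx) (mul_ne_zero hy hs))
        -- Here `l = s α` makes `s' = 1`, and the common value becomes `x' = y' = x ^ 2 α ^ 4 / (y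
        -- s)`: a class modulo fourth powers.
        refine ⟨.G6 b, Model.nonempty_extGroup_mulEquiv hp (α := α) (β := 0)
          (δ := x * α ^ 2 / y) (l := s * α) hα
          (div_ne_zero (mul_ne_zero hx (pow_ne_zero 2 hα)) hy) (mul_ne_zero hs hα)
          ?_ ?_ ?_ ?_⟩ <;> simp [exponents, ht, natCast_wPow]
        · rw [← hb]; field_simp
        · rw [← hb]; field_simp
    · obtain ⟨a, α, hα, ha⟩ := exists_mul_pow_eq hw (k := 3) (by norm_num) (div_ne_zero hx ht)
      have hδ : x * α ^ 2 / y ≠ 0 := div_ne_zero (mul_ne_zero hx (pow_ne_zero 2 hα)) hy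
      refine ⟨.G5 a, Model.nonempty_extGroup_mulEquiv hp (α := α) (β := -(s * α / t))
          (δ := x * α ^ 2 / y) (l := t * (x * α ^ 2 / y)) hα hδ (mul_ne_zero ht hδ)
          ?_ ?_ ?_ ?_⟩ <;> simp [exponents, natCast_wPow]
      · rw [← ha]; field_simp
      · rw [← ha]; field_simp
      · field_simp; ring

theorem eq_of_listedGroup_mulEquiv (hp : 3 < p)
    (hw : ∀ x : (ZMod p)ˣ, x ∈ Subgroup.zpowers w) {i j : Index p}
    (h : Nonempty (ListedGroup w i ≃* ListedGroup w j)) : i = j := by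
  obtain ⟨f⟩ := h
  obtain ⟨fi⟩ := nonempty_listedGroup_mulEquiv hp w i
  obtain ⟨fj⟩ := nonempty_listedGroup_mulEquiv hp w j
  obtain ⟨α, β, δ, l, hα, hδ, hl, h1, h2, h3, h4⟩ := Model.exists_change_of_generators hp
    (exponents_fst_ne_zero w i) ((fi.symm.trans f).trans fj)
  -- Pairs of different types are excluded by the vanishing patterns of `y`, `t` and `s`. In the
  -- surviving cases the primed parameters belong to `j`, so the power relation leads from `b` to
  -- `a`.
  cases i <;> cases j <;>
    simp [exponents, natCast_wPow, hα, hδ, hl, hl.symm] at h1 h2 h3 h4 ⊢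
  case G2.G2 a b =>
    subst h4
    exact (eq_of_pow_mul_pow_eq (a := b) (b := a) hw hα
      (mul_left_cancel₀ hδ (by linear_combination h1))).symm
  case G5.G5 a b =>
    subst h4
    exact (eq_of_pow_mul_pow_eq (a := b) (b := a) hw hα
      (mul_left_cancel₀ hδ (by linear_combination h1))).symm
  case G6.G6 a b =>
    subst h3
    have hb : (w : ZMod p) ^ (b : ℕ) ≠ 0 := pow_ne_zero _ w.ne_zero
    have e : δ = α ^ 2 :=
      mul_left_cancel₀ (mul_ne_zero (mul_ne_zero hb hα) hδ) (by linear_combination h2 - h1)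
    subst e
    exact (eq_of_pow_mul_pow_eq (a := b) (b := a) hw hα
      (mul_left_cancel₀ hα (by linear_combination h1))).symm

end
end PDesc

/-! ### Counting the isomorphism classes. -/

namespace PDesc

/-- The index set as a disjoint union. -/
def indexEquiv (p : ℕ) : Index p ≃ Unit ⊕ Unit ⊕ Unit ⊕ Fin (Nat.gcd 4 (p - 1)) ⊕
    Fin (Nat.gcd 3 (p - 1)) ⊕ Fin (Nat.gcd 3 (p - 1)) where
  toFun
    | .G1 => .inl ()
    | .G3 => .inr (.inl ())
    | .G4 => .inr (.inr (.inl ()))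
    | .G6 b => .inr (.inr (.inr (.inl b)))
    | .G2 a => .inr (.inr (.inr (.inr (.inl a))))
    | .G5 a => .inr (.inr (.inr (.inr (.inr a))))
  invFun
    | .inl () => .G1
    | .inr (.inl ()) => .G3
    | .inr (.inr (.inl ())) => .G4
    | .inr (.inr (.inr (.inl b))) => .G6 b
    | .inr (.inr (.inr (.inr (.inl a)))) => .G2 a
    | .inr (.inr (.inr (.inr (.inr a)))) => .G5 a
  left_inv i := by cases i <;> rfl
  right_inv i := by rcases i with _ | _ | _ | _ | _ | _ <;> rfl

theorem card_index (p : ℕ) :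
    Nat.card (Index p) = 3 + Nat.gcd 4 (p - 1) + 2 * Nat.gcd 3 (p - 1) := by
  rw [Nat.card_congr (indexEquiv p)]
  simp only [Nat.card_sum, Nat.card_unique, Nat.card_fin]
  ring

variable {p : ℕ} [Fact p.Prime]

theorem card_listedGroup (hp : 3 < p) (w : (ZMod p)ˣ) (i : Index p) :
    Nat.card (ListedGroup w i) = p ^ 5 := by
  obtain ⟨f⟩ := nonempty_listedGroup_mulEquiv hp w i
  rw [Nat.card_congr f.toEquiv, Model.card_eq]

theorem isImmediateDescendant_listedGroup (hp : 3 < p) (w : (ZMod p)ˣ) (i : Index p) :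
    IsImmediateDescendant p (BaseGroup p) (ListedGroup w i) := by
  obtain ⟨f⟩ := nonempty_listedGroup_mulEquiv hp w i
  exact (Model.isImmediateDescendant hp (exponents_fst_ne_zero w i)).congr f.symm

theorem exists_mulEquiv_listedGroup (hp : 3 < p) {w : (ZMod p)ˣ}
    (hw : ∀ x : (ZMod p)ˣ, x ∈ Subgroup.zpowers w) {H : Type*} [Group H] [Group.FG H]
    (hcard : Nat.card H = p ^ 5) (hH : IsImmediateDescendant p (BaseGroup p) H) :
    ∃ i : Index p, Nonempty (H ≃* ListedGroup w i) := by
  obtain ⟨x, y, s, t, hx, ⟨f⟩⟩ := exists_model_mulEquiv hp hcard hH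
  obtain ⟨i, ⟨g⟩⟩ := exists_listedGroup_mulEquiv hp hw (y := y) (s := s) (t := t) hx
  exact ⟨i, ⟨f.trans g.symm⟩⟩

/-- The isomorphism class of a group in the list. -/
def listedClass (w : (ZMod p)ˣ) (i : Index p) :
    Quotient (CategoryTheory.isIsomorphicSetoid GrpCat.{u}) :=
  Quotient.mk _ (GrpCat.of (ULift.{u} (ListedGroup w i)))

theorem listedClass_injective (hp : 3 < p) {w : (ZMod p)ˣ}
    (hw : ∀ x : (ZMod p)ˣ, x ∈ Subgroup.zpowers w) : Function.Injective (listedClass.{u} w) := by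
  intro i j hij
  obtain ⟨e⟩ : Nonempty (GrpCat.of (ULift.{u} (ListedGroup w i)) ≅
    GrpCat.of (ULift.{u} (ListedGroup w j))) := Quotient.exact hij
  exact eq_of_listedGroup_mulEquiv hp hw
    ⟨MulEquiv.ulift.symm.trans (e.groupIsoToMulEquiv.trans MulEquiv.ulift)⟩

/-- The listed groups live in the lowest universe, so they are compared with groups in universe `u`
through `ULift`, which respects being an immediate descendant. -/
theorem descendantClasses_eq_range (hp : 3 < p) {w : (ZMod p)ˣ}
    (hw : ∀ x : (ZMod p)ˣ, x ∈ Subgroup.zpowers w) :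
    descendantClasses.{u} p (BaseGroup p) (p ^ 5) = Set.range (listedClass.{u} w) := by
  ext q
  constructor
  · rintro ⟨H, hfin, rfl, hcard, hH⟩
    obtain ⟨i, ⟨f⟩⟩ := exists_mulEquiv_listedGroup hp hw hcard hH
    exact ⟨i, Quotient.sound ⟨(MulEquiv.ulift.trans f.symm).toGrpIso⟩⟩
  · rintro ⟨i, rfl⟩
    have h := isImmediateDescendant_listedGroup hp w i
    have hfin := h.finite
    refine ⟨GrpCat.of (ULift.{u} (ListedGroup w i)), inferInstanceAs (Finite (ULift _)), rfl, ?_, ?_⟩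
    · exact (Nat.card_congr Equiv.ulift).trans (card_listedGroup hp w i)
    · exact h.congr MulEquiv.ulift.symm

end PDesc

theorem mainTheorem6 (p : ℕ) [Fact p.Prime] (hp : 3 < p) (w : (ZMod p)ˣ)
    (hw : ∀ x : (ZMod p)ˣ, x ∈ Subgroup.zpowers w) :
    Nat.card (PDesc.BaseGroup p) = p ^ 4 ∧
    (∀ i : PDesc.Index p, Nat.card (PDesc.ListedGroup w i) = p ^ 5 ∧
      PDesc.IsImmediateDescendant p (PDesc.BaseGroup p) (PDesc.ListedGroup w i)) ∧
    (∀ i j : PDesc.Index p,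
      Nonempty (PDesc.ListedGroup w i ≃* PDesc.ListedGroup w j) → i = j) ∧
    (∀ (H : Type u) [Group H] [Finite H], Nat.card H = p ^ 5 →
      PDesc.IsImmediateDescendant p (PDesc.BaseGroup p) H →
      ∃ i : PDesc.Index p, Nonempty (H ≃* PDesc.ListedGroup w i)) ∧
    (PDesc.descendantClasses.{u} p (PDesc.BaseGroup p) (p ^ 5)).ncard =
      3 + Nat.gcd 4 (p - 1) + 2 * Nat.gcd 3 (p - 1) := by
  refine ⟨PDesc.card_baseGroup hp, fun i => ⟨PDesc.card_listedGroup hp w i,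
    PDesc.isImmediateDescendant_listedGroup hp w i⟩,
    fun i j => PDesc.eq_of_listedGroup_mulEquiv hp hw,
    fun H _ _ => PDesc.exists_mulEquiv_listedGroup hp hw, ?_⟩
  rw [PDesc.descendantClasses_eq_range hp hw, ← Nat.card_coe_set_eq,
    Nat.card_range_of_injective (PDesc.listedClass_injective hp hw), PDesc.card_index]
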